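/- Let $\sigma>0$, let $\mathbb T=\mathbb R/2\pi\mathbb Z$ and $\Pi=\mathbb T\times[0,1]$, and let $m>3$ be an integer. All functions are complex valued. For real $s\ge 0$, $X_\sigma^{s}$ is the space of functions $a$ on $\mathbb T$ with Fourier series $a(x)=\sum_k\hat a_k e^{ikx}$ and $$\|a\|_{X_\sigma^s}^2=\sum_{k\in\mathbb Z}(1+k^2)^s e^{2\sigma|k|}|\hat a_k|^2<\infty .$$ For an integer $n\ge 0$, $H^n[0,1]$ is the usual Sobolev space, with $\|u\|^2=\sum_{p\le n}\|D^pu\|_{L^2[0,1]}^2$, and $Y_\sigma^n$ is the space of functions $a$ on $\Pi$ with partial Fourier series $a(x,\psi)=\sum_k\hat a_k(\psi)e^{ikx}$ and (with $0^0=1$) $$\|a\|_{Y_\sigma^n}^2=\sum_{\substack{p,q\ge 0\\ p+q\le n}}\ \sum_{k\in\mathbb Z}k^{2q}e^{2\sigma|k|}\,\|D^p\hat a_k\|_{L^2[0,1]}^2<\infty .$$ Let $$\Phi(a)=-\frac{1}{a_\psi}a_{xx}+\frac{2a_x}{a_\psi^2}a_{x\psi}-\frac{1+a_x^2}{a_\psi^3}a_{\psi\psi}.$$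 Then the function $\psi$, that is $(x,\psi)\mapsto\psi$, belongs to $Y_\sigma^m$, and there is $\varepsilon>0$ such that, with $U=\{a\in Y_\sigma^m:\|a-\psi\|_{Y_\sigma^m}<\varepsilon\}$, the following holds. Every $a\in U$ has first and second order partial derivatives on $\Pi$ (one-sided in $\psi$ at $\psi=0,1$), and $a_\psi$ vanishes nowhere on $\Pi$. The operator $$T(f,g,F,a)=\bigl(\Phi(a)-F(\psi),\ a(x,0)-f(x),\ a(x,1)-g(x)\bigr)$$ is well defined from $X_\sigma^{m-1/2}\times X_\sigma^{m-1/2}\times H^{m-2}[0,1]\times U$ to $Y_\sigma^{m-2}\times X_\sigma^{m-1/2}\times X_\sigma^{m-1/2}$, and it is complex analytic there. -/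

import Mathlib

noncomputable section

open MeasureTheory Set
open scoped ContDiff

namespace FlowLines

/-! ### The Sobolev spaces `H^m[0,1]` -/

/-- The space `L²[0,1]` of complex valued functions. -/
abbrev L2I : Type := Lp ℂ 2 (volume.restrict (Icc (0 : ℝ) 1))

/-- `v` is the weak derivative of `u` on the interval `(0,1)`. -/
def IsWeakDeriv (u v : L2I) : Prop :=
  ∀ φ : ℝ → ℝ, ContDiff ℝ ∞ φ → HasCompactSupport φ → tsupport φ ⊆ Ioo 0 1 →
    ∫ t in Icc (0 : ℝ) 1, deriv φ t • u t = -∫ t in Icc (0 : ℝ) 1, φ t • v t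

lemma integrable_test {g : ℝ → ℝ} (hg : Continuous g) (u : L2I) :
    Integrable (fun t => g t • u t) (volume.restrict (Icc (0 : ℝ) 1)) := by
  have hu : Integrable (fun t => u t) (volume.restrict (Icc (0 : ℝ) 1)) :=
    (Lp.memLp u).integrable (by norm_num)
  obtain ⟨C, hC⟩ := isCompact_Icc.exists_bound_of_continuousOn (s := Icc (0 : ℝ) 1) hg.continuousOn
  refine hu.bdd_smul C hg.aestronglyMeasurable ?_
  filter_upwards [ae_restrict_mem measurableSet_Icc] with t ht using hC t ht

/-- Functions in `L²[0,1]` with `m` weak derivatives in `L²[0,1]`, recorded as the tuple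
`(u, Du, …, D^m u)` (which is determined by `u`). -/
def sobolevSubmodule (m : ℕ) : Submodule ℂ (PiLp 2 fun _ : Fin (m + 1) => L2I) where
  carrier := {U | ∀ j : Fin m, IsWeakDeriv (U j.castSucc) (U j.succ)}
  zero_mem' := by
    intro j φ _ _ _
    have h : ∀ g : ℝ → ℝ, ∫ t in Icc (0 : ℝ) 1, g t • (0 : L2I) t = 0 := by
      intro g
      rw [integral_congr_ae (g := fun _ => (0 : ℂ))]
      · simp
      · filter_upwards [Lp.coeFn_zero ℂ 2 (volume.restrict (Icc (0 : ℝ) 1))] with t ht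
        rw [ht]
        exact smul_zero _
    simp only [PiLp.zero_apply, h, neg_zero]
  add_mem' := by
    intro U V hU hV j φ h1 h2 h3
    have h : ∀ g : ℝ → ℝ, Continuous g → ∀ u v : L2I, ∫ t in Icc (0 : ℝ) 1, g t • (u + v) t =
        (∫ t in Icc (0 : ℝ) 1, g t • u t) + ∫ t in Icc (0 : ℝ) 1, g t • v t := by
      intro g hg u v
      rw [← integral_add (integrable_test hg u) (integrable_test hg v)]
      refine integral_congr_ae ?_
      filter_upwards [Lp.coeFn_add u v] with t ht
      simp only [ht, Pi.add_apply, smul_add]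
    rw [PiLp.add_apply, PiLp.add_apply, h _ (h1.continuous_deriv (by simp)),
      h _ h1.continuous, hU j φ h1 h2 h3, hV j φ h1 h2 h3]
    ring
  smul_mem' := by
    intro c U hU j φ h1 h2 h3
    have h : ∀ g : ℝ → ℝ, ∀ u : L2I, ∫ t in Icc (0 : ℝ) 1, g t • (c • u) t =
        c * ∫ t in Icc (0 : ℝ) 1, g t • u t := by
      intro g u
      rw [← integral_const_mul]
      refine integral_congr_ae ?_
      filter_upwards [Lp.coeFn_smul c u] with t ht
      simp only [ht, Pi.smul_apply, smul_eq_mul, Complex.real_smul]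
      ring
    rw [PiLp.smul_apply, PiLp.smul_apply, h, h, hU j φ h1 h2 h3]
    ring

/-- The Sobolev space `H^m[0,1]` with the norm `‖u‖² = ∑_{p ≤ m} ‖D^p u‖²_{L²}`. -/
abbrev Sobolev (m : ℕ) : Type := sobolevSubmodule m

/-- The weak derivative `D^p u`, for `p ≤ m`. -/
def Sobolev.D {m : ℕ} (u : Sobolev m) (p : Fin (m + 1)) : L2I := u.1 p

lemma Sobolev.norm_sq_eq {m : ℕ} (u : Sobolev m) : ‖u‖ ^ 2 = ∑ p, ‖u.D p‖ ^ 2 :=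
  PiLp.norm_sq_eq_of_L2 _ u.1

open Classical in
/-- The value of `u ∈ H^m[0,1]`, `m ≥ 1`, at a point of `[0,1]`: the value of the continuous
representative of `u`. -/
def Sobolev.val {m : ℕ} (u : Sobolev m) : ℝ → ℂ :=
  if h : ∃ v : ℝ → ℂ, ContinuousOn v (Icc 0 1) ∧ u.D 0 =ᵐ[volume.restrict (Icc (0 : ℝ) 1)] v
  then h.choose else 0

lemma continuous_test {g : ℝ → ℝ} (hg : Continuous g) :
    Continuous fun u : L2I => ∫ t in Icc (0 : ℝ) 1, g t • u t := by
  have hm : MemLp (fun t => (g t : ℂ)) 2 (volume.restrict (Icc (0 : ℝ) 1)) := by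
    obtain ⟨C, hC⟩ :=
      isCompact_Icc.exists_bound_of_continuousOn (s := Icc (0 : ℝ) 1) hg.continuousOn
    refine MemLp.of_bound (by fun_prop) C ?_
    filter_upwards [ae_restrict_mem measurableSet_Icc] with t ht
    simpa using hC t ht
  have : (fun u : L2I => ∫ t in Icc (0 : ℝ) 1, g t • u t) =
      fun u : L2I => inner ℂ (hm.toLp _) u := by
    funext u
    rw [L2.inner_def]
    refine integral_congr_ae ?_
    filter_upwards [hm.coeFn_toLp] with t ht
    simp [ht, mul_comm]
  rw [this]
  fun_prop

lemma isClosed_sobolevSubmodule (m : ℕ) :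
    IsClosed (sobolevSubmodule m : Set (PiLp 2 fun _ : Fin (m + 1) => L2I)) := by
  have : (sobolevSubmodule m : Set (PiLp 2 fun _ : Fin (m + 1) => L2I)) =
      {U | ∀ j : Fin m, IsWeakDeriv (U j.castSucc) (U j.succ)} := rfl
  rw [this]
  simp only [IsWeakDeriv, ofPred_forall]
  refine isClosed_iInter fun j => isClosed_iInter fun φ => isClosed_iInter fun h1 =>
    isClosed_iInter fun _ => isClosed_iInter fun _ => isClosed_eq ?_ ?_
  · exact (continuous_test (h1.continuous_deriv (by simp))).comp (by fun_prop)
  · exact ((continuous_test h1.continuous).comp (by fun_prop)).neg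

instance (m : ℕ) : CompleteSpace (Sobolev m) :=
  (isClosed_sobolevSubmodule m).completeSpace_coe

/-! ### Fourier series on the circle -/

instance fact_two_pi_pos : Fact (0 < 2 * Real.pi) := ⟨Real.two_pi_pos⟩

/-- The circle `ℝ / 2πℤ`. For `a : 𝕋 → E`, `fourierCoeff a k` is
`(2π)⁻¹ ∫ a(x) e^{-ikx} dx`. -/
abbrev Torus : Type := AddCircle (2 * Real.pi)

section Fourier

lemma integrable_torus {E : Type*} [NormedAddCommGroup E] (a : C(Torus, E)) : Integrable a (AddCircle.haarAddCircle) :=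
  a.continuous.integrable_of_hasCompactSupport (HasCompactSupport.of_compactSpace _)

variable {E : Type*} [NormedAddCommGroup E] [InnerProductSpace ℂ E]

lemma fourierCoeff_add' (a b : C(Torus, E)) (k : ℤ) :
    fourierCoeff (⇑(a + b)) k = fourierCoeff a k + fourierCoeff b k := by
  rw [ContinuousMap.coe_add, fourierCoeff.add (integrable_torus a) (integrable_torus b)]
  rfl

lemma fourierCoeff_smul' (c : ℂ) (a : C(Torus, E)) (k : ℤ) :
    fourierCoeff (⇑(c • a)) k = c • fourierCoeff a k :=
  fourierCoeff.const_smul _ c k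

lemma fourierCoeff_zero' (k : ℤ) : fourierCoeff (⇑(0 : C(Torus, E))) k = 0 := by
  simp [fourierCoeff]

lemma eq_zero_of_fourierCoeff_scalar (a : C(Torus, ℂ)) (h : ∀ k, fourierCoeff a k = 0) :
    a = 0 := by
  have h1 : ContinuousMap.toLp (E := ℂ) 2 AddCircle.haarAddCircle ℂ a = 0 := by
    apply (fourierBasis (T := 2 * Real.pi)).repr.injective
    ext k
    rw [fourierBasis_repr, fourierCoeff_toLp, h k]
    simp
  have : (AddCircle.haarAddCircle (T := 2 * Real.pi)).IsOpenPosMeasure := inferInstance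
  exact ContinuousMap.toLp_injective (E := ℂ) (p := 2) (𝕜 := ℂ)
    (AddCircle.haarAddCircle (T := 2 * Real.pi)) (by rw [h1, map_zero])

lemma eq_zero_of_fourierCoeff [CompleteSpace E] (a : C(Torus, E))
    (h : ∀ k, fourierCoeff a k = 0) : a = 0 := by
  ext x
  have key : ∀ w : E, inner ℂ w (a x) = 0 := by
    intro w
    let b : C(Torus, ℂ) := ⟨fun y => innerSL ℂ w (a y), by fun_prop⟩
    have hb : b = 0 := by
      apply eq_zero_of_fourierCoeff_scalar
      intro k
      have := (innerSL ℂ w).integral_comp_comm ((integrable_torus a).fourier_smul (-k))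
      have h2 := h k
      unfold fourierCoeff at h2 ⊢
      rw [h2, map_zero] at this
      rw [← this]
      refine integral_congr_ae (Filter.Eventually.of_forall fun t => ?_)
      simp only [map_smul]
      rfl
    exact congrArg (fun f : C(Torus, ℂ) => f x) hb
  simpa using key (a x)

end Fourier

/-! ### The spaces `X_σ^s` of analytic functions on the circle -/

/-- The `k`-th term of the squared norm of `X_σ^s`, for a function with `k`-th Fourier
coefficient `c`. -/
def xTerm (σ s : ℝ) (k : ℤ) (c : ℂ) : ℝ :=
  (1 + (k : ℝ) ^ 2) ^ s * Real.exp (2 * σ * |(k : ℝ)|) * ‖c‖ ^ 2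

/-- The `k`-th term of the squared norm of `Y_σ^m`, for a function with `k`-th partial Fourier
coefficient `u ∈ H^m[0,1]`. -/
def yTerm (σ : ℝ) (m : ℕ) (k : ℤ) (u : Sobolev m) : ℝ :=
  ∑ p : Fin (m + 1), ∑ q ∈ Finset.range (m - p + 1),
    (k : ℝ) ^ (2 * q) * Real.exp (2 * σ * |(k : ℝ)|) * ‖u.D p‖ ^ 2

/-- `xTerm` as the squared norm of a linear image of the coefficient. -/
def xLin (σ s : ℝ) (k : ℤ) : ℂ →ₗ[ℂ] ℂ :=
  (Real.sqrt ((1 + (k : ℝ) ^ 2) ^ s * Real.exp (2 * σ * |(k : ℝ)|)) : ℂ) • LinearMap.id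

lemma xLin_norm (σ s : ℝ) (k : ℤ) (c : ℂ) : ‖xLin σ s k c‖ ^ 2 = xTerm σ s k c := by
  have h : 0 ≤ (1 + (k : ℝ) ^ 2) ^ s * Real.exp (2 * σ * |(k : ℝ)|) := by positivity
  simp only [xLin, xTerm, LinearMap.smul_apply, LinearMap.id_apply, norm_smul, mul_pow,
    Complex.norm_real, Real.norm_eq_abs, sq_abs, Real.sq_sqrt h]

/-- The weight of `‖D^p u‖²` in `yTerm`. -/
def yWeight (σ : ℝ) (m : ℕ) (k : ℤ) (p : Fin (m + 1)) : ℝ :=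
  ∑ q ∈ Finset.range (m - p + 1), (k : ℝ) ^ (2 * q) * Real.exp (2 * σ * |(k : ℝ)|)

lemma yWeight_nonneg (σ : ℝ) (m : ℕ) (k : ℤ) (p : Fin (m + 1)) : 0 ≤ yWeight σ m k p := by
  refine Finset.sum_nonneg fun q _ => ?_
  rw [pow_mul]
  positivity

lemma yWeight_pos (σ : ℝ) (m : ℕ) (k : ℤ) (p : Fin (m + 1)) : 0 < yWeight σ m k p := by
  refine Finset.sum_pos' (fun q _ => ?_) ⟨0, by simp, ?_⟩
  · rw [pow_mul]; positivity
  · simp [Real.exp_pos]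

/-- `yTerm` as the squared norm of a linear image of the coefficient. -/
def yLin (σ : ℝ) (m : ℕ) (k : ℤ) : Sobolev m →ₗ[ℂ] PiLp 2 fun _ : Fin (m + 1) => L2I where
  toFun u := WithLp.toLp 2 fun p => (Real.sqrt (yWeight σ m k p) : ℂ) • u.D p
  map_add' u v := by
    ext1 p
    simp [Sobolev.D]
  map_smul' c u := by
    ext1 p
    exact smul_comm _ c _

lemma yLin_norm (σ : ℝ) (m : ℕ) (k : ℤ) (u : Sobolev m) :
    ‖yLin σ m k u‖ ^ 2 = yTerm σ m k u := by
  rw [PiLp.norm_sq_eq_of_L2]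
  refine Finset.sum_congr rfl fun p _ => ?_
  simp only [yLin, LinearMap.coe_mk, AddHom.coe_mk, norm_smul, mul_pow,
    Complex.norm_real, Real.norm_eq_abs, sq_abs, Real.sq_sqrt (yWeight_nonneg σ m k p)]
  rw [yWeight, Finset.sum_mul]

section Weighted

variable {E G : Type*} [NormedAddCommGroup E] [InnerProductSpace ℂ E]
  [NormedAddCommGroup G] [NormedSpace ℂ G]

lemma memlp_iff (L : ℤ → E →ₗ[ℂ] G) (a : C(Torus, E)) :
    Memℓp (fun k => L k (fourierCoeff a k)) 2 ↔
      Summable fun k => ‖L k (fourierCoeff a k)‖ ^ 2 := by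
  rw [memℓp_gen_iff (by norm_num)]
  simp

lemma summable_weighted_add (L : ℤ → E →ₗ[ℂ] G) {a b : C(Torus, E)}
    (ha : Summable fun k => ‖L k (fourierCoeff a k)‖ ^ 2)
    (hb : Summable fun k => ‖L k (fourierCoeff b k)‖ ^ 2) :
    Summable fun k => ‖L k (fourierCoeff (⇑(a + b)) k)‖ ^ 2 := by
  rw [← memlp_iff] at *
  simp only [fourierCoeff_add', map_add]
  exact ha.add hb

lemma summable_weighted_smul (L : ℤ → E →ₗ[ℂ] G) (c : ℂ) {a : C(Torus, E)}
    (ha : Summable fun k => ‖L k (fourierCoeff a k)‖ ^ 2) :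
    Summable fun k => ‖L k (fourierCoeff (⇑(c • a)) k)‖ ^ 2 := by
  rw [← memlp_iff] at *
  simp only [fourierCoeff_smul', map_smul]
  exact ha.const_smul c

lemma summable_weighted_zero (L : ℤ → E →ₗ[ℂ] G) :
    Summable fun k => ‖L k (fourierCoeff (⇑(0 : C(Torus, E))) k)‖ ^ 2 := by
  simp only [fourierCoeff_zero', map_zero, norm_zero]
  simp

/-- The square root of `∑ ‖L_k â_k‖²` is a norm on functions for which the sum is finite. -/
lemma weighted_core [CompleteSpace E] (L : ℤ → E →ₗ[ℂ] G) (hL : ∀ k u, L k u = 0 → u = 0)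
    {S : Type*} [AddCommGroup S] [Module ℂ S] [Norm S] (ι : S →ₗ[ℂ] C(Torus, E))
    (hι : Function.Injective ι)
    (hsum : ∀ a, Summable fun k => ‖L k (fourierCoeff (ι a) k)‖ ^ 2)
    (hnorm : ∀ a, ‖a‖ = Real.sqrt (∑' k, ‖L k (fourierCoeff (ι a) k)‖ ^ 2)) :
    NormedSpace.Core ℂ S := by
  have hmem : ∀ a, Memℓp (fun k => L k (fourierCoeff (ι a) k)) 2 := fun a =>
    (memlp_iff L (ι a)).2 (hsum a)
  let J : S → lp (fun _ : ℤ => G) 2 := fun a => ⟨_, hmem a⟩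
  have hJ : ∀ a, ‖a‖ = ‖J a‖ := by
    intro a
    rw [hnorm, Real.sqrt_eq_iff_eq_sq (tsum_nonneg fun k => by positivity) (norm_nonneg _)]
    have := lp.norm_rpow_eq_tsum (p := 2) (by norm_num) (J a)
    simpa [J] using this.symm
  have hadd : ∀ a b, J (a + b) = J a + J b := by
    intro a b
    ext k
    change L k (fourierCoeff (ι (a + b)) k) =
      L k (fourierCoeff (ι a) k) + L k (fourierCoeff (ι b) k)
    rw [map_add, fourierCoeff_add', map_add]
  have hsmul : ∀ (c : ℂ) a, J (c • a) = c • J a := by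
    intro c a
    ext k
    change L k (fourierCoeff (ι (c • a)) k) = c • L k (fourierCoeff (ι a) k)
    rw [map_smul, fourierCoeff_smul', map_smul]
  refine ⟨⟨fun a => ?_, fun c a => ?_, fun a b => ?_⟩, fun a => ⟨fun h => ?_, fun h => ?_⟩⟩
  · rw [hJ]; exact norm_nonneg _
  · rw [hJ, hJ, hsmul, norm_smul]
  · rw [hJ, hJ, hJ, hadd]; exact norm_add_le _ _
  · rw [hJ, norm_eq_zero] at h
    apply hι
    rw [map_zero]
    refine eq_zero_of_fourierCoeff _ fun k => hL k _ ?_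
    simpa [J] using congrArg (fun f : lp (fun _ : ℤ => G) 2 => (f : ℤ → G) k) h
  · subst h
    rw [hJ, norm_eq_zero]
    ext k
    simp [J, fourierCoeff_zero', -ContinuousMap.coe_zero]

end Weighted

/-- Functions `a` on the circle with
`∑_k (1 + k²)^s e^{2σ|k|} |â_k|² < ∞`. -/
def xSubmodule (σ s : ℝ) : Submodule ℂ C(Torus, ℂ) where
  carrier := {a | Summable fun k : ℤ => xTerm σ s k (fourierCoeff a k)}
  zero_mem' := by
    simp only [mem_ofPred_eq, ← xLin_norm]
    exact summable_weighted_zero _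
  add_mem' := by
    intro a b ha hb
    simp only [mem_ofPred_eq, ← xLin_norm] at *
    exact summable_weighted_add _ ha hb
  smul_mem' := by
    intro c a ha
    simp only [mem_ofPred_eq, ← xLin_norm] at *
    exact summable_weighted_smul _ c ha

/-- The space `X_σ^s`, `σ > 0`. Its elements are continuous because `σ > 0`. -/
def XSpace (σ s : ℝ) : Type := xSubmodule σ s

namespace XSpace

variable {σ s : ℝ}

instance : AddCommGroup (XSpace σ s) := inferInstanceAs (AddCommGroup (xSubmodule σ s))

instance : Module ℂ (XSpace σ s) := inferInstanceAs (Module ℂ (xSubmodule σ s))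

/-- An element of `X_σ^s` as a function on the circle. -/
def toFun : XSpace σ s →ₗ[ℂ] C(Torus, ℂ) := (xSubmodule σ s).subtype

instance : Norm (XSpace σ s) :=
  ⟨fun a => Real.sqrt (∑' k : ℤ, xTerm σ s k (fourierCoeff a.toFun k))⟩

lemma core : NormedSpace.Core ℂ (XSpace σ s) := by
  refine weighted_core (xLin σ s) (fun k u hu => ?_) toFun Subtype.val_injective
    (fun a => ?_) (fun a => ?_)
  · have h : 0 < Real.sqrt ((1 + (k : ℝ) ^ 2) ^ s * Real.exp (2 * σ * |(k : ℝ)|)) := by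
      positivity
    have h' : (Real.sqrt ((1 + (k : ℝ) ^ 2) ^ s * Real.exp (2 * σ * |(k : ℝ)|)) : ℂ) ≠ 0 :=
      Complex.ofReal_ne_zero.2 h.ne'
    exact (smul_eq_zero.1 hu).resolve_left h'
  · simp only [xLin_norm]; exact a.2
  · simp only [xLin_norm]; rfl

instance : NormedAddCommGroup (XSpace σ s) := NormedAddCommGroup.ofCore core

instance : NormedSpace ℂ (XSpace σ s) := NormedSpace.ofCore core

/-- The value `a(x)`, `x ∈ ℝ`, of the `2π`-periodic function `a`. -/
def val (a : XSpace σ s) (x : ℝ) : ℂ := a.toFun (x : Torus)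

end XSpace

/-! ### The spaces `Y_σ^m` of partially analytic functions -/

/-- Functions `a : 𝕋 → H^m[0,1]`, `x ↦ a(x, ·)`, with
`∑_{p + q ≤ m} ∑_k k^{2q} e^{2σ|k|} ‖D^p â_k‖² < ∞`. -/
def ySubmodule (σ : ℝ) (m : ℕ) : Submodule ℂ C(Torus, Sobolev m) where
  carrier := {a | Summable fun k : ℤ => yTerm σ m k (fourierCoeff a k)}
  zero_mem' := by
    simp only [mem_ofPred_eq, ← yLin_norm]
    exact summable_weighted_zero _
  add_mem' := by
    intro a b ha hb
    simp only [mem_ofPred_eq, ← yLin_norm] at *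
    exact summable_weighted_add _ ha hb
  smul_mem' := by
    intro c a ha
    simp only [mem_ofPred_eq, ← yLin_norm] at *
    exact summable_weighted_smul _ c ha

/-- The space `Y_σ^m`, `σ > 0`. Its elements are continuous in `x` with values in `H^m[0,1]`
because `σ > 0`. -/
def YSpace (σ : ℝ) (m : ℕ) : Type := ySubmodule σ m

namespace YSpace

variable {σ : ℝ} {m : ℕ}

instance : AddCommGroup (YSpace σ m) := inferInstanceAs (AddCommGroup (ySubmodule σ m))

instance : Module ℂ (YSpace σ m) := inferInstanceAs (Module ℂ (ySubmodule σ m))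

/-- An element of `Y_σ^m` as a function `x ↦ a(x, ·)`. -/
def toFun : YSpace σ m →ₗ[ℂ] C(Torus, Sobolev m) := (ySubmodule σ m).subtype

instance : Norm (YSpace σ m) :=
  ⟨fun a => Real.sqrt (∑' k : ℤ, yTerm σ m k (fourierCoeff a.toFun k))⟩

lemma core : NormedSpace.Core ℂ (YSpace σ m) := by
  refine weighted_core (yLin σ m) (fun k u hu => ?_) toFun Subtype.val_injective
    (fun a => ?_) (fun a => ?_)
  · apply Subtype.ext
    ext1 p
    have hp := congrArg (fun U : PiLp 2 (fun _ : Fin (m + 1) => L2I) => U p) hu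
    have h' : (Real.sqrt (yWeight σ m k p) : ℂ) ≠ 0 :=
      Complex.ofReal_ne_zero.2 (Real.sqrt_pos.2 (yWeight_pos σ m k p)).ne'
    exact (smul_eq_zero.1 hp).resolve_left h'
  · simp only [yLin_norm]; exact a.2
  · simp only [yLin_norm]; rfl

instance : NormedAddCommGroup (YSpace σ m) := NormedAddCommGroup.ofCore core

instance : NormedSpace ℂ (YSpace σ m) := NormedSpace.ofCore core

/-- The value `a(x,ψ)`, `x ∈ ℝ`, `ψ ∈ [0,1]`, for `m ≥ 1`. -/
def val (a : YSpace σ m) (x ψ : ℝ) : ℂ := (a.toFun (x : Torus)).val ψ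

end YSpace

/-! ### The quasilinear operator `Φ` -/

/-- Partial derivative in `x`. -/
def dx (a : ℝ → ℝ → ℂ) (x ψ : ℝ) : ℂ := deriv (fun y => a y ψ) x

/-- Partial derivative in `ψ ∈ [0,1]` (one-sided at the end points). -/
def dψ (a : ℝ → ℝ → ℂ) (x ψ : ℝ) : ℂ := derivWithin (a x) (Icc 0 1) ψ

/-- `a` has first partial derivatives on the strip `ℝ × [0,1]`. -/
def HasPartials (a : ℝ → ℝ → ℂ) : Prop :=
  ∀ x : ℝ, ∀ ψ ∈ Icc (0 : ℝ) 1,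
    DifferentiableAt ℝ (fun y => a y ψ) x ∧ DifferentiableWithinAt ℝ (a x) (Icc 0 1) ψ

/-- `Φ(a) = -a_xx / a_ψ + 2 a_x a_xψ / a_ψ² - (1 + a_x²) a_ψψ / a_ψ³`. -/
def Phi (a : ℝ → ℝ → ℂ) (x ψ : ℝ) : ℂ :=
  -1 / dψ a x ψ * dx (dx a) x ψ
    + 2 * dx a x ψ / dψ a x ψ ^ 2 * dψ (dx a) x ψ
    - (1 + dx a x ψ ^ 2) / dψ a x ψ ^ 3 * dψ (dψ a) x ψ

end FlowLines

end

open FlowLines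

noncomputable section

namespace FlowLines

open MeasureTheory Set
open scoped ContDiff BoundedContinuousFunction ENNReal

/-! Every term of `Φ(a)` is a product of derivatives of `a` and powers of `1 / a_ψ`. Derivatives and
traces are bounded linear maps, so analyticity follows once multiplication is a bounded bilinear map
on `Y_σ^{m-2}` and multiplication by `a_ψ` is invertible there for `a` near `ψ`. The condition `m >
3` enters as `m - 2 ≥ 2`.

Multiplication (`exists_mulL`): in Fourier variables a product is a convolution, and `e^{σ|k|}` is
submultiplicative, so Young's inequality applies to the weighted coefficients. One derivative in `ψ`
turns `L²` norms into sup norms, and one derivative in `x` turns `ℓ²` into `ℓ¹`. Hence two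
derivatives, shared in any way between the factors, put a product in weighted `L²`
(`InY.l2_absConv_le`). Higher regularity follows from the Leibniz rule by induction
(`exists_inY_conv`). The induction needs factors of different regularity, because differentiation
lowers only one of them.

Weak derivatives are handled through `isWeakDeriv_iff`: `v` is the weak derivative of `u` exactly
when `u` is a constant plus the primitive of `v`. This is a closed linear condition on `(u, v)`. It
yields the Leibniz rule, differentiation of infinite sums, and classical one-sided derivatives.

Traces lose half a derivative (`xTerm_ev_le`): an interpolation inequality is applied to the `k`-th
coefficient on an interval of length `(1 + k²)^{-1/2}`.

Division: at `a = ψ` multiplication by `a_ψ` is the identity operator. Nearby it is invertible by a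
Neumann series in the algebra of bounded operators on the complete space `Y_σ^{m-2}`
(`isUnit_mulL`), and inversion of operators is analytic (`analyticAt_phiY`). Finally `val_phiY`
identifies the abstract operator with the pointwise formula. -/

/-! ### Weak derivatives and primitives on `[0,1]` -/

/-- Lebesgue measure on `[0,1]`. -/
abbrev μI : Measure ℝ := volume.restrict (Icc (0 : ℝ) 1)

instance : IsProbabilityMeasure μI := ⟨by simp⟩

/-- Bounded continuous functions as elements of `L²[0,1]`. -/
def incl : (ℝ →ᵇ ℂ) →L[ℂ] L2I := BoundedContinuousFunction.toLp 2 μI ℂ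

lemma coeFn_incl (f : ℝ →ᵇ ℂ) : incl f =ᵐ[μI] f :=
  BoundedContinuousFunction.coeFn_toLp (p := 2) (𝕜 := ℂ) μI f

lemma denseRange_incl : DenseRange incl :=
  BoundedContinuousFunction.toLp_denseRange ℂ μI ℂ (by norm_num)

lemma incl_eq_iff (f : ℝ →ᵇ ℂ) (u : L2I) : incl f = u ↔ u =ᵐ[μI] f :=
  ⟨fun h => h ▸ coeFn_incl f, fun h => Lp.ext ((coeFn_incl f).trans h.symm)⟩

lemma incl_congr {f g : ℝ →ᵇ ℂ} (h : EqOn f g (Icc 0 1)) : incl f = incl g := by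
  rw [incl_eq_iff]
  filter_upwards [coeFn_incl g, ae_restrict_mem measurableSet_Icc] with t h1 h2
  rw [h1, h h2]

lemma integrable_L2I (u : L2I) : Integrable u μI := (Lp.memLp u).integrable (by norm_num)

lemma integral_norm_le (u : L2I) : ∫ t, ‖u t‖ ∂μI ≤ ‖u‖ := by
  have h := eLpNorm_le_eLpNorm_of_exponent_le (p := 1) (q := 2) (μ := μI) (by norm_num)
    (Lp.aestronglyMeasurable u)
  rw [Lp.norm_def, integral_norm_eq_lintegral_enorm (Lp.aestronglyMeasurable u),
    ← eLpNorm_one_eq_lintegral_enorm]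
  exact ENNReal.toReal_mono (Lp.eLpNorm_ne_top u) h

/-- The integral over `[0,1]`. -/
def meanL : L2I →L[ℂ] ℂ :=
  LinearMap.mkContinuous
    { toFun := fun u => ∫ t, u t ∂μI
      map_add' := fun u v => by
        rw [← integral_add (integrable_L2I u) (integrable_L2I v)]
        exact integral_congr_ae (Lp.coeFn_add u v)
      map_smul' := fun c u => by
        rw [RingHom.id_apply, ← integral_smul]
        exact integral_congr_ae (Lp.coeFn_smul c u) } 1
    fun u => by
      rw [one_mul]
      exact (norm_integral_le_integral_norm _).trans (integral_norm_le u)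

lemma meanL_apply (u : L2I) : meanL u = ∫ t, u t ∂μI := rfl

/-- Integrating against `μI` instead of Lebesgue measure makes the bound valid for all real
endpoints, so a primitive is a bounded continuous function on the whole line. -/
lemma norm_prim_le (v : L2I) (a b : ℝ) : ‖∫ s in a..b, v s ∂μI‖ ≤ ‖v‖ := by
  refine (intervalIntegral.norm_integral_le_integral_norm_uIoc).trans ?_
  refine (setIntegral_le_integral (integrable_L2I v).norm ?_).trans (integral_norm_le v)
  exact Filter.Eventually.of_forall fun t => norm_nonneg _

/-- The primitive `t ↦ ∫₀ᵗ v`, extended by constants outside `[0,1]`. -/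
def primL : L2I →L[ℂ] (ℝ →ᵇ ℂ) :=
  LinearMap.mkContinuous
    { toFun := fun v => BoundedContinuousFunction.ofNormedAddCommGroup
        (fun t => ∫ s in (0 : ℝ)..t, v s ∂μI)
        (intervalIntegral.continuous_primitive
          (fun a b => (integrable_L2I v).intervalIntegrable) 0) ‖v‖ (fun t => norm_prim_le v 0 t)
      map_add' := fun u v => by
        ext t
        simp only [BoundedContinuousFunction.coe_ofNormedAddCommGroup,
          BoundedContinuousFunction.coe_add, Pi.add_apply]
        rw [← intervalIntegral.integral_add (integrable_L2I u).intervalIntegrable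
          (integrable_L2I v).intervalIntegrable]
        refine intervalIntegral.integral_congr_ae_restrict ?_
        exact ae_restrict_of_ae (Lp.coeFn_add u v)
      map_smul' := fun c u => by
        ext t
        simp only [BoundedContinuousFunction.coe_ofNormedAddCommGroup,
          BoundedContinuousFunction.coe_smul, RingHom.id_apply]
        rw [← intervalIntegral.integral_smul]
        refine intervalIntegral.integral_congr_ae_restrict ?_
        exact ae_restrict_of_ae (Lp.coeFn_smul c u) } 1
    fun v => by
      rw [one_mul]
      exact (BoundedContinuousFunction.norm_le (norm_nonneg v)).2 fun t => norm_prim_le v 0 t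

lemma primL_apply (v : L2I) (t : ℝ) : primL v t = ∫ s in (0 : ℝ)..t, v s ∂μI := rfl

lemma primL_incl (f : ℝ →ᵇ ℂ) {t : ℝ} (ht : t ∈ Icc (0 : ℝ) 1) :
    primL (incl f) t = ∫ s in (0 : ℝ)..t, f s := by
  rw [primL_apply, intervalIntegral.integral_of_le ht.1, intervalIntegral.integral_of_le ht.1,
    Measure.restrict_restrict measurableSet_Ioc,
    inter_eq_self_of_subset_left (Ioc_subset_Icc_self.trans (Icc_subset_Icc_right ht.2))]
  refine integral_congr_ae ?_
  have := ae_restrict_of_ae_restrict_of_subset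
    (Ioc_subset_Icc_self.trans (Icc_subset_Icc_right ht.2)) (coeFn_incl f)
  exact this

lemma primL_one_eq_meanL (v : L2I) : primL v 1 = meanL v := by
  rw [primL_apply, meanL_apply, intervalIntegral.integral_of_le zero_le_one,
    Measure.restrict_restrict measurableSet_Ioc,
    inter_eq_self_of_subset_left Ioc_subset_Icc_self, restrict_Ioc_eq_restrict_Icc]

lemma memLp_bcf_mul (f : ℝ →ᵇ ℂ) (u : L2I) : MemLp (fun t => f t * u t) 2 μI := by
  refine (Lp.memLp u).of_le_mul (c := ‖f‖)
    (f.continuous.aestronglyMeasurable.mul (Lp.aestronglyMeasurable u))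
    (Filter.Eventually.of_forall fun t => ?_)
  rw [norm_mul]
  gcongr
  exact f.norm_coe_le_norm t

/-- Product of a bounded continuous function and an element of `L²[0,1]`. -/
def mulBL : (ℝ →ᵇ ℂ) →L[ℂ] L2I →L[ℂ] L2I :=
  LinearMap.mkContinuous₂
    (LinearMap.mk₂ ℂ (fun f u => (memLp_bcf_mul f u).toLp (fun t => f t * u t))
      (fun f g u => by
        rw [← MemLp.toLp_add]
        congr 1
        ext t
        simp [add_mul])
      (fun c f u => by
        rw [← MemLp.toLp_const_smul]
        congr 1
        ext t
        simp [mul_assoc])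
      (fun f u v => by
        rw [← MemLp.toLp_add]
        refine MemLp.toLp_congr _ _ ?_
        filter_upwards [Lp.coeFn_add u v] with t ht
        change f t * (u + v : L2I) t = f t * u t + f t * v t
        rw [ht, Pi.add_apply, mul_add])
      (fun c f u => by
        rw [← MemLp.toLp_const_smul]
        refine MemLp.toLp_congr _ _ ?_
        filter_upwards [Lp.coeFn_smul c u] with t ht
        simp [ht, mul_left_comm])) 1
    (fun f u => by
      rw [one_mul]
      refine Lp.norm_le_mul_norm_of_ae_le_mul ?_
      filter_upwards [MemLp.coeFn_toLp (memLp_bcf_mul f u)] with t ht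
      simp only [LinearMap.mk₂_apply]
      rw [ht, norm_mul]
      gcongr
      exact f.norm_coe_le_norm t)

lemma coeFn_mulBL (f : ℝ →ᵇ ℂ) (u : L2I) : mulBL f u =ᵐ[μI] fun t => f t * u t :=
  MemLp.coeFn_toLp (memLp_bcf_mul f u)

lemma mulBL_incl (f g : ℝ →ᵇ ℂ) : mulBL f (incl g) = incl (f * g) := by
  symm
  rw [incl_eq_iff]
  filter_upwards [coeFn_mulBL f (incl g), coeFn_incl g] with t h1 h2
  rw [h1, h2]; rfl

/-- Evaluation of bounded continuous functions. -/
def evB (t : ℝ) : (ℝ →ᵇ ℂ) →L[ℂ] ℂ := BoundedContinuousFunction.evalCLM ℂ t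

lemma evB_apply (t : ℝ) (f : ℝ →ᵇ ℂ) : evB t f = f t := rfl

/-- Product rule for primitives. -/
lemma primL_mul_primL (u v : L2I) {t : ℝ} (ht : t ∈ Icc (0 : ℝ) 1) :
    primL u t * primL v t = primL (mulBL (primL v) u + mulBL (primL u) v) t := by
  -- Both sides are continuous in `(u, v)`, so it suffices to treat continuous integrands, where the
  -- identity is integration by parts.
  refine denseRange_incl.induction_on₂ (p := fun u v =>
    primL u t * primL v t = primL (mulBL (primL v) u + mulBL (primL u) v) t) ?_ ?_ u v
  · refine isClosed_eq ?_ ?_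
    · exact (((evB t).comp primL).continuous.comp continuous_fst).mul
        (((evB t).comp primL).continuous.comp continuous_snd)
    · refine ((evB t).comp primL).continuous.comp ?_
      fun_prop
  · intro f g
    have hd : ∀ h : ℝ →ᵇ ℂ, ∀ s, HasDerivAt (fun s => ∫ r in (0 : ℝ)..s, h r) (h s) s :=
      fun h s => intervalIntegral.integral_hasDerivAt_right (h.continuous.intervalIntegrable _ _)
        (h.continuous.stronglyMeasurableAtFilter _ _) h.continuous.continuousAt
    have key := intervalIntegral.integral_deriv_mul_eq_sub (a := 0) (b := t)
      (fun s _ => hd f s) (fun s _ => hd g s) (f.continuous.intervalIntegrable _ _)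
      (g.continuous.intervalIntegrable _ _)
    rw [primL_incl f ht, primL_incl g ht, mulBL_incl, mulBL_incl, ← map_add, primL_incl _ ht]
    simp only [intervalIntegral.integral_same, zero_mul, sub_zero] at key
    rw [← key]
    refine intervalIntegral.integral_congr fun s hs => ?_
    rw [uIcc_of_le ht.1] at hs
    have hs' : s ∈ Icc (0 : ℝ) 1 := ⟨hs.1, hs.2.trans ht.2⟩
    simp only [BoundedContinuousFunction.coe_add, BoundedContinuousFunction.coe_mul, Pi.add_apply,
      Pi.mul_apply, primL_incl _ hs']
    ring

/-- A compactly supported continuous real function as a bounded continuous complex function. -/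
def testB (φ : ℝ → ℝ) (h1 : Continuous φ) (h2 : HasCompactSupport φ) : ℝ →ᵇ ℂ :=
  BoundedContinuousFunction.ofNormedAddCommGroup (fun t => (φ t : ℂ)) (by fun_prop)
    (h2.exists_bound_of_continuous h1).choose (fun t => by
      simpa using (h2.exists_bound_of_continuous h1).choose_spec t)

lemma testB_apply (φ : ℝ → ℝ) (h1 : Continuous φ) (h2 : HasCompactSupport φ) (t : ℝ) :
    testB φ h1 h2 t = φ t := rfl

/-- Constants as bounded continuous functions. -/
def constB : ℂ →L[ℂ] (ℝ →ᵇ ℂ) :=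
  LinearMap.mkContinuous
    { toFun := BoundedContinuousFunction.const ℝ
      map_add' := fun _ _ => rfl
      map_smul' := fun _ _ => rfl } 1
    fun c => by rw [one_mul]; exact BoundedContinuousFunction.norm_const_le c

lemma constB_apply (c : ℂ) (t : ℝ) : constB c t = c := rfl

lemma meanL_incl_constB (c : ℂ) : meanL (incl (constB c)) = c := by
  rw [meanL_apply, integral_congr_ae (coeFn_incl _)]
  simp [constB_apply]

lemma meanL_mulBL_testB (φ : ℝ → ℝ) (h1 : Continuous φ) (h2 : HasCompactSupport φ) (u : L2I) :
    meanL (mulBL (testB φ h1 h2) u) = ∫ t in Icc (0 : ℝ) 1, φ t • u t := by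
  rw [meanL_apply]
  refine integral_congr_ae ?_
  filter_upwards [coeFn_mulBL (testB φ h1 h2) u] with t ht
  rw [ht, testB_apply, Complex.real_smul]

lemma eq_zero_of_tsupport {φ : ℝ → ℝ} {s : Set ℝ} (h : tsupport φ ⊆ s) {t : ℝ} (ht : t ∉ s) :
    φ t = 0 := by
  by_contra h'
  exact ht (h (subset_tsupport _ h'))

/-- On `[0,1]` a test function is the primitive of its derivative, so the product rule at `t = 1`,
where `φ` vanishes, is the defining identity. The constant drops out because `φ'` has zero integral.
-/
lemma isWeakDeriv_prim (c : ℂ) (v : L2I) : IsWeakDeriv (incl (constB c + primL v)) v := by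
  intro φ h1 h2 h3
  have hd : Continuous (deriv φ) := h1.continuous_deriv (by simp)
  have hprim : EqOn (primL (incl (testB _ hd h2.deriv))) (testB φ h1.continuous h2)
      (Icc 0 1) := by
    intro t ht
    rw [primL_incl _ ht, testB_apply]
    simp only [testB_apply]
    rw [intervalIntegral.integral_ofReal, intervalIntegral.integral_deriv_eq_sub
      (fun s _ => (h1.differentiable (by simp)).differentiableAt) (hd.intervalIntegrable _ _),
      eq_zero_of_tsupport h3 (t := 0) (by simp), sub_zero]
  have hone : (1 : ℝ) ∈ Icc (0 : ℝ) 1 := by simp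
  have hzero : primL (incl (testB _ hd h2.deriv)) 1 = 0 := by
    rw [hprim hone, testB_apply, eq_zero_of_tsupport h3 (t := 1) (by simp), Complex.ofReal_zero]
  have key := primL_mul_primL (incl (testB _ hd h2.deriv)) v hone
  rw [hzero, zero_mul, primL_one_eq_meanL, map_add, mulBL_incl] at key
  rw [← meanL_mulBL_testB φ h1.continuous h2, ← meanL_mulBL_testB _ hd h2.deriv, mulBL_incl,
    mul_add, map_add, map_add, mul_comm _ (primL v)]
  have hc : meanL (incl (testB _ hd h2.deriv * constB c)) = 0 := by
    have : testB _ hd h2.deriv * constB c = c • testB _ hd h2.deriv := by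
      ext t
      simp [constB_apply, mul_comm]
    rw [this, map_smul, map_smul, ← primL_one_eq_meanL, hzero, smul_zero]
  have hφ : mulBL (testB φ h1.continuous h2) v
      = mulBL (primL (incl (testB _ hd h2.deriv))) v := by
    apply Lp.ext
    filter_upwards [coeFn_mulBL (testB φ h1.continuous h2) v,
      coeFn_mulBL (primL (incl (testB _ hd h2.deriv))) v, ae_restrict_mem measurableSet_Icc]
      with t a b ht
    rw [a, b, hprim ht]
  rw [hc, zero_add, hφ]
  exact eq_neg_of_add_eq_zero_left key.symm

/-- A smooth function with compact support in `(0,1)` and zero integral is the derivative of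
such a function. -/
lemma exists_test_primitive {θ : ℝ → ℝ} (h1 : ContDiff ℝ ∞ θ) (h2 : HasCompactSupport θ)
    (h3 : tsupport θ ⊆ Ioo 0 1) (h0 : ∫ t, θ t = 0) :
    ∃ φ : ℝ → ℝ, ContDiff ℝ ∞ φ ∧ HasCompactSupport φ ∧ tsupport φ ⊆ Ioo 0 1 ∧
      deriv φ = θ := by
  rcases (tsupport θ).eq_empty_or_nonempty with he | hne
  · refine ⟨0, contDiff_const, HasCompactSupport.zero, by simp, ?_⟩
    rw [tsupport_eq_empty_iff] at he
    rw [he]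
    funext t
    simp
  -- With `[α, β]` the hull of the support, the primitive vanishes left of `α` trivially and right
  -- of `β` because the total integral is zero.
  obtain ⟨α, hα, hα'⟩ := h2.exists_isLeast hne
  obtain ⟨β, hβ, hβ'⟩ := h2.exists_isGreatest hne
  have hderiv : ∀ t, HasDerivAt (fun t => ∫ s in (0 : ℝ)..t, θ s) (θ t) t := fun t =>
    intervalIntegral.integral_hasDerivAt_right (h1.continuous.intervalIntegrable _ _)
      (h1.continuous.stronglyMeasurableAtFilter _ _) h1.continuous.continuousAt
  have hd : deriv (fun t => ∫ s in (0 : ℝ)..t, θ s) = θ := funext fun t => (hderiv t).deriv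
  have hzero : ∀ t, t ∉ Icc α β → ∫ s in (0 : ℝ)..t, θ s = 0 := by
    intro t ht
    rcases lt_or_ge t α with h | h
    · rw [intervalIntegral.integral_congr (g := fun _ => 0), intervalIntegral.integral_zero]
      intro s hs
      have hs' : s < α := hs.2.trans_lt (max_lt (h3 hα).1 h)
      refine eq_zero_of_tsupport (s := tsupport θ) subset_rfl fun h => ?_
      exact absurd (hα' h) (not_le.2 hs')
    · have hlt : β < t := by
        by_contra hh
        exact ht ⟨h, not_lt.1 hh⟩
      rw [intervalIntegral.integral_eq_integral_of_support_subset, h0]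
      intro s hs
      have := subset_tsupport _ hs
      exact ⟨(h3 this).1, (hβ' this).trans hlt.le⟩
  have hts : tsupport (fun t => ∫ s in (0 : ℝ)..t, θ s) ⊆ Icc α β := by
    refine closure_minimal (fun t ht => ?_) isClosed_Icc
    by_contra h
    exact ht (hzero t h)
  refine ⟨fun t => ∫ s in (0 : ℝ)..t, θ s, ?_, ?_, hts.trans ?_, hd⟩
  · rw [contDiff_infty_iff_deriv]
    exact ⟨fun t => (hderiv t).differentiableAt, by rw [hd]; exact h1⟩
  · exact isCompact_Icc.of_isClosed_subset (isClosed_tsupport _) hts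
  · exact Icc_subset_Ioo (h3 hα).1 (h3 hβ).2

lemma setIntegral_test {χ : ℝ → ℝ} (h3 : tsupport χ ⊆ Ioo 0 1) :
    ∫ t in Icc (0 : ℝ) 1, χ t = ∫ t, χ t :=
  setIntegral_eq_integral_of_forall_compl_eq_zero fun _ ht =>
    eq_zero_of_tsupport (h3.trans Ioo_subset_Icc_self) ht

/-- The lemma of du Bois-Reymond. -/
lemma exists_const_of_integral_deriv_eq_zero (w : L2I)
    (h : ∀ φ : ℝ → ℝ, ContDiff ℝ ∞ φ → HasCompactSupport φ → tsupport φ ⊆ Ioo 0 1 →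
      ∫ t in Icc (0 : ℝ) 1, deriv φ t • w t = 0) : ∃ c, w = incl (constB c) := by
  let B : ContDiffBump (1 / 2 : ℝ) := ⟨1 / 8, 1 / 4, by norm_num, by norm_num⟩
  let η : ℝ → ℝ := B.normed volume
  have η1 : ContDiff ℝ ∞ η := B.contDiff_normed
  have η2 : HasCompactSupport η := B.hasCompactSupport_normed
  have η3 : tsupport η ⊆ Ioo 0 1 := by
    rw [show tsupport η = _ from B.tsupport_normed_eq, Real.closedBall_eq_Icc]
    refine Icc_subset_Ioo ?_ ?_
    · change (0 : ℝ) < 1 / 2 - 1 / 4; norm_num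
    · change (1 : ℝ) / 2 + 1 / 4 < 1; norm_num
  have η4 : ∫ t, η t = 1 := B.integral_normed
  set C : ℂ := ∫ t in Icc (0 : ℝ) 1, η t • w t with hC
  have key : ∀ᵐ t ∂μI, t ∈ Ioo (0 : ℝ) 1 → w t - C = 0 := by
    refine isOpen_Ioo.ae_eq_zero_of_integral_contDiff_smul_eq_zero
      (((integrable_L2I w).sub (integrable_const C)).locallyIntegrable.locallyIntegrableOn _) ?_
    intro χ χ1 χ2 χ3
    -- Since `η` has integral one, `χ - (∫ χ) η` has integral zero and is therefore the derivative
    -- of a test function. The hypothesis on `w` then becomes `∫ χ (w - C) = 0` with `C = ∫ η w`.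
    have θ1 : ContDiff ℝ ∞ (fun t => χ t - (∫ s, χ s) * η t) := χ1.sub (contDiff_const.mul η1)
    have θ3 : tsupport (fun t => χ t - (∫ s, χ s) * η t) ⊆ tsupport χ ∪ tsupport η := by
      refine closure_minimal (fun t ht => ?_)
        ((isClosed_tsupport _).union (isClosed_tsupport _))
      by_contra hh
      rw [mem_union, not_or] at hh
      refine ht ?_
      simp only [image_eq_zero_of_notMem_tsupport hh.1, image_eq_zero_of_notMem_tsupport hh.2]
      simp
    obtain ⟨φ, φ1, φ2, φ3, φ4⟩ := exists_test_primitive θ1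
      ((IsCompact.union χ2 η2).of_isClosed_subset (isClosed_tsupport _) θ3)
      (θ3.trans (union_subset χ3 η3)) (by
        rw [integral_sub (χ1.continuous.integrable_of_hasCompactSupport χ2)
          ((η1.continuous.integrable_of_hasCompactSupport η2).const_mul _), integral_const_mul, η4]
        ring)
    have h0 := h φ φ1 φ2 φ3
    rw [φ4] at h0
    have hi : Integrable (fun t => (∫ s, χ s) • η t • w t) μI :=
      (integrable_test η1.continuous w).smul (∫ s, χ s)
    have e1 : ∫ t in Icc (0 : ℝ) 1, (χ t - (∫ s, χ s) * η t) • w t =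
        (∫ t in Icc (0 : ℝ) 1, χ t • w t) - (∫ s, χ s) • C := by
      rw [hC, ← integral_smul, ← integral_sub (integrable_test χ1.continuous w) hi]
      refine integral_congr_ae (Filter.Eventually.of_forall fun t => ?_)
      simp only [sub_smul, mul_smul]
    rw [e1] at h0
    simp only [smul_sub]
    rw [integral_sub (integrable_test χ1.continuous w)
      ((χ1.continuous.integrable_of_hasCompactSupport χ2).restrict.smul_const C),
      integral_smul_const, setIntegral_test χ3]
    exact h0
  refine ⟨C, ?_⟩
  symm
  rw [incl_eq_iff]
  have hm : ∀ᵐ t ∂μI, t ∈ Ioo (0 : ℝ) 1 := by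
    rw [μI, ← restrict_Ioo_eq_restrict_Icc]
    exact ae_restrict_mem measurableSet_Ioo
  filter_upwards [key, hm] with t h1 h2
  rw [constB_apply]
  exact sub_eq_zero.1 (h1 h2)

/-- The bounded continuous representative of `u`, given its weak derivative `v`. -/
def repL : L2I × L2I →L[ℂ] (ℝ →ᵇ ℂ) :=
  constB ∘L meanL ∘L (.fst ℂ L2I L2I - incl ∘L primL ∘L .snd ℂ L2I L2I) + primL ∘L .snd ℂ L2I L2I

lemma repL_apply (u v : L2I) :
    repL (u, v) = constB (meanL (u - incl (primL v))) + primL v := rfl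

/-- The difference of `u` and the primitive of `v` has weak derivative zero, hence is constant. As
`[0,1]` has measure one, the constant equals its mean, which is what `repL` adds back. -/
lemma IsWeakDeriv.incl_repL {u v : L2I} (h : IsWeakDeriv u v) : incl (repL (u, v)) = u := by
  obtain ⟨c, hc⟩ := exists_const_of_integral_deriv_eq_zero (u - incl (primL v)) (by
    intro φ h1 h2 h3
    have hd : Continuous (deriv φ) := h1.continuous_deriv (by simp)
    have h0 := isWeakDeriv_prim 0 v φ h1 h2 h3
    rw [map_zero, zero_add, ← h φ h1 h2 h3, ← meanL_mulBL_testB _ hd h2.deriv,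
      ← meanL_mulBL_testB _ hd h2.deriv] at h0
    rw [← meanL_mulBL_testB _ hd h2.deriv, map_sub, map_sub, h0, sub_self])
  rw [repL_apply, hc, meanL_incl_constB, map_add, ← hc, sub_add_cancel]

/-- This replaces test functions by an equation between continuous linear maps of `(u, v)`, so weak
differentiability passes to sums and limits. -/
lemma isWeakDeriv_iff {u v : L2I} : IsWeakDeriv u v ↔ incl (repL (u, v)) = u :=
  ⟨fun h => h.incl_repL, fun h => h ▸ isWeakDeriv_prim _ v⟩

lemma isWeakDeriv_zero : IsWeakDeriv 0 0 := by
  rw [isWeakDeriv_iff, show ((0 : L2I), (0 : L2I)) = 0 from rfl, map_zero, map_zero]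

lemma IsWeakDeriv.add {u v u' v' : L2I} (h : IsWeakDeriv u u') (h' : IsWeakDeriv v v') :
    IsWeakDeriv (u + v) (u' + v') := by
  rw [isWeakDeriv_iff] at *
  rw [← Prod.mk_add_mk, map_add, map_add, h, h']

lemma IsWeakDeriv.hasSum {ι : Type*} {f f' : ι → L2I} {u u' : L2I} (hf : HasSum f u)
    (hf' : HasSum f' u') (h : ∀ i, IsWeakDeriv (f i) (f' i)) : IsWeakDeriv u u' := by
  rw [isWeakDeriv_iff]
  have h1 := (incl ∘L repL).hasSum (hf.prodMk hf')
  refine h1.unique ?_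
  convert hf using 1
  funext i
  exact (h i).incl_repL

/-- Weak derivatives are unique. -/
lemma IsWeakDeriv.unique {u v v' : L2I} (h : IsWeakDeriv u v) (h' : IsWeakDeriv u v') :
    v = v' := by
  rw [← sub_eq_zero]
  have key : ∀ᵐ t ∂μI, t ∈ Ioo (0 : ℝ) 1 → (v - v') t = 0 := by
    refine isOpen_Ioo.ae_eq_zero_of_integral_contDiff_smul_eq_zero
      ((integrable_L2I _).locallyIntegrable.locallyIntegrableOn _) ?_
    intro χ χ1 χ2 χ3
    have := h χ χ1 χ2 χ3
    rw [h' χ χ1 χ2 χ3, neg_inj] at this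
    change ∫ t in Icc (0 : ℝ) 1, χ t • (v - v') t = 0
    rw [← meanL_mulBL_testB _ χ1.continuous χ2, ← meanL_mulBL_testB _ χ1.continuous χ2] at this
    rw [← meanL_mulBL_testB _ χ1.continuous χ2, map_sub, map_sub, this, sub_self]
  have hm : ∀ᵐ t ∂μI, t ∈ Ioo (0 : ℝ) 1 := by
    rw [μI, ← restrict_Ioo_eq_restrict_Icc]
    exact ae_restrict_mem measurableSet_Ioo
  apply Lp.ext
  filter_upwards [key, hm, Lp.coeFn_zero ℂ 2 μI] with t h1 h2 h3
  rw [h1 h2, h3]; rfl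

/-! ### Products and pointwise bounds -/

open Classical in
/-- The product of `u, v ∈ L²[0,1]` if it belongs to `L²[0,1]`, and `0` otherwise. -/
def mulL2 (u v : L2I) : L2I :=
  if h : MemLp (fun t => u t * v t) 2 μI then h.toLp _ else 0

lemma mulL2_comm (u v : L2I) : mulL2 u v = mulL2 v u := by
  have e : (fun t => u t * v t) = fun t => v t * u t := funext fun t => mul_comm _ _
  by_cases h : MemLp (fun t => u t * v t) 2 μI
  · have h' : MemLp (fun t => v t * u t) 2 μI := e ▸ h
    rw [mulL2, mulL2, dif_pos h, dif_pos h']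
    exact MemLp.toLp_congr _ _ (Filter.EventuallyEq.of_eq e)
  · have h' : ¬ MemLp (fun t => v t * u t) 2 μI := e ▸ h
    rw [mulL2, mulL2, dif_neg h, dif_neg h']

lemma mulL2_incl_left (f : ℝ →ᵇ ℂ) (v : L2I) : mulL2 (incl f) v = mulBL f v := by
  have hae : (fun t => incl f t * v t) =ᵐ[μI] fun t => f t * v t := by
    filter_upwards [coeFn_incl f] with t ht
    rw [ht]
  have h : MemLp (fun t => incl f t * v t) 2 μI := (memLp_bcf_mul f v).ae_eq hae.symm
  rw [mulL2, dif_pos h]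
  apply Lp.ext
  filter_upwards [h.coeFn_toLp, hae, coeFn_mulBL f v] with t h1 h2 h3
  rw [h1, h2, h3]

lemma mulL2_incl_right (u : L2I) (f : ℝ →ᵇ ℂ) : mulL2 u (incl f) = mulBL f u := by
  rw [mulL2_comm, mulL2_incl_left]

lemma mulL2_smul_left (c : ℂ) (u v : L2I) : mulL2 (c • u) v = c • mulL2 u v := by
  have hae : (fun t => (c • u) t * v t) =ᵐ[μI] c • fun t => u t * v t := by
    filter_upwards [Lp.coeFn_smul c u] with t ht
    simp [ht, mul_assoc]
  rcases eq_or_ne c 0 with rfl | hc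
  · rw [zero_smul, zero_smul]
    have h0 : (fun t => (0 : L2I) t * v t) =ᵐ[μI] 0 := by
      filter_upwards [Lp.coeFn_zero ℂ 2 μI] with t ht
      rw [ht]; simp
    have h : MemLp (fun t => (0 : L2I) t * v t) 2 μI := MemLp.zero.ae_eq h0.symm
    rw [mulL2, dif_pos h]
    exact Lp.ext ((h.coeFn_toLp.trans h0).trans (Lp.coeFn_zero ℂ 2 μI).symm)
  · by_cases h : MemLp (fun t => u t * v t) 2 μI
    · have h' : MemLp (fun t => (c • u) t * v t) 2 μI := (h.const_smul c).ae_eq hae.symm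
      rw [mulL2, mulL2, dif_pos h, dif_pos h', ← MemLp.toLp_const_smul]
      exact MemLp.toLp_congr _ _ hae
    · have h' : ¬ MemLp (fun t => (c • u) t * v t) 2 μI := fun h' => h <| by
        refine ((h'.ae_eq hae).const_smul c⁻¹).ae_eq ?_
        rw [inv_smul_smul₀ hc]
      rw [mulL2, mulL2, dif_neg h, dif_neg h', smul_zero]

lemma mulL2_smul_right (c : ℂ) (u v : L2I) : mulL2 u (c • v) = c • mulL2 u v := by
  rw [mulL2_comm, mulL2_smul_left, mulL2_comm]

/-- The essential supremum of `|u|` on `[0,1]`. -/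
def supE (u : L2I) : ℝ≥0∞ := eLpNorm u ⊤ μI

/-- The default value `0` of `mulL2` keeps the bound true when the product is not square integrable,
so the convolution estimates carry no integrability conditions. -/
lemma enorm_mulL2_le_left (u v : L2I) : ‖mulL2 u v‖ₑ ≤ supE u * ‖v‖ₑ := by
  by_cases h : MemLp (fun t => u t * v t) 2 μI
  · rw [mulL2, dif_pos h, Lp.enorm_def, Lp.enorm_def, eLpNorm_congr_ae h.coeFn_toLp]
    exact eLpNorm_smul_le_eLpNorm_top_mul_eLpNorm 2 (Lp.aestronglyMeasurable v) u
  · rw [mulL2, dif_neg h]; simp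

lemma enorm_mulL2_le_right (u v : L2I) : ‖mulL2 u v‖ₑ ≤ ‖u‖ₑ * supE v := by
  rw [mulL2_comm, mul_comm]
  exact enorm_mulL2_le_left v u

lemma mulBL_constB (c : ℂ) (v : L2I) : mulBL (constB c) v = c • v := by
  apply Lp.ext
  filter_upwards [coeFn_mulBL (constB c) v, Lp.coeFn_smul c v] with t h1 h2
  rw [h1, h2, constB_apply]; rfl

/-- Each factor is a constant plus a primitive. By `primL_mul_primL` their product is the constant
`c * d` plus the primitive of the Leibniz expression. -/
lemma IsWeakDeriv.mulL2 {u u' v v' : L2I} (h : IsWeakDeriv u u') (h' : IsWeakDeriv v v') :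
    IsWeakDeriv (mulL2 u v) (mulL2 u' v + FlowLines.mulL2 u v') := by
  set c := meanL (u - incl (primL u')) with hc
  set d := meanL (v - incl (primL v')) with hd
  have hu := h.incl_repL
  have hv := h'.incl_repL
  rw [repL_apply, ← hc] at hu
  rw [repL_apply, ← hd] at hv
  have key : incl (constB (c * d) + primL (mulBL (constB d + primL v') u' +
      mulBL (constB c + primL u') v')) = incl ((constB c + primL u') * (constB d + primL v')) := by
    refine incl_congr fun t ht => ?_
    simp only [map_add, add_apply, mulBL_constB, map_smul,
      BoundedContinuousFunction.coe_add, BoundedContinuousFunction.coe_mul, Pi.add_apply,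
      Pi.mul_apply, constB_apply, BoundedContinuousFunction.coe_smul, smul_eq_mul]
    have := primL_mul_primL u' v' ht
    rw [map_add, BoundedContinuousFunction.coe_add, Pi.add_apply] at this
    linear_combination -this
  rw [← hu, ← hv, mulL2_incl_left, mulL2_incl_left, mulL2_incl_right, mulBL_incl, ← key]
  exact isWeakDeriv_prim _ _

lemma setIntegral_norm_le (w : L2I) {a b : ℝ} (hab : a ≤ b) :
    ∫ t in Icc a b, ‖w t‖ ∂μI ≤ Real.sqrt (b - a) * ‖w‖ := by
  have hm : AEStronglyMeasurable w (μI.restrict (Icc a b)) :=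
    (Lp.aestronglyMeasurable w).restrict
  have h := eLpNorm_le_eLpNorm_mul_rpow_measure_univ (p := 1) (q := 2)
    (μ := μI.restrict (Icc a b)) (by norm_num) hm
  have h2 : eLpNorm w 2 (μI.restrict (Icc a b)) ≤ eLpNorm w 2 μI :=
    eLpNorm_mono_measure _ Measure.restrict_le_self
  have h3 : (μI.restrict (Icc a b)) univ ≤ ENNReal.ofReal (b - a) := by
    rw [Measure.restrict_apply_univ, ← Real.volume_Icc]
    exact Measure.restrict_le_self _
  have h4 : ∫ t in Icc a b, ‖w t‖ ∂μI = (eLpNorm w 1 (μI.restrict (Icc a b))).toReal := by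
    rw [eLpNorm_one_eq_lintegral_enorm, integral_norm_eq_lintegral_enorm hm]
  rw [h4, Lp.norm_def, ← ENNReal.toReal_ofReal (Real.sqrt_nonneg (b - a)), ← ENNReal.toReal_mul]
  refine ENNReal.toReal_mono
    (ENNReal.mul_ne_top ENNReal.ofReal_ne_top (Lp.eLpNorm_ne_top w)) (h.trans ?_)
  rw [mul_comm]
  refine mul_le_mul' ?_ h2
  refine (ENNReal.rpow_le_rpow h3 (by norm_num)).trans ?_
  rw [Real.sqrt_eq_rpow, ENNReal.ofReal_rpow_of_nonneg (by linarith) (by norm_num)]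
  refine ENNReal.ofReal_le_ofReal (le_of_eq ?_)
  norm_num

lemma norm_repL_sub_le {u u' : L2I} {a b x y : ℝ} (hx : x ∈ Icc a b) (hy : y ∈ Icc a b) :
    ‖repL (u, u') x - repL (u, u') y‖ ≤ Real.sqrt (b - a) * ‖u'‖ := by
  have : repL (u, u') x - repL (u, u') y = ∫ s in y..x, u' s ∂μI := by
    simp only [repL_apply, BoundedContinuousFunction.coe_add, Pi.add_apply, constB_apply,
      primL_apply]
    rw [add_sub_add_left_eq_sub, intervalIntegral.integral_interval_sub_left
      (integrable_L2I u').intervalIntegrable (integrable_L2I u').intervalIntegrable]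
  rw [this]
  refine intervalIntegral.norm_integral_le_integral_norm_uIoc.trans
    (le_trans ?_ (setIntegral_norm_le u' (hx.1.trans hx.2)))
  refine setIntegral_mono_set (integrable_L2I u').norm.integrableOn
    (Filter.Eventually.of_forall fun t => norm_nonneg _) (LE.le.eventuallyLE ?_)
  exact uIoc_subset_uIcc.trans (uIcc_subset_Icc hy hx)

/-- A pointwise bound by the `L²` norms of a function and its derivative, which is an
interpolation inequality when the length of the interval is optimized. -/
lemma IsWeakDeriv.norm_repL_le {u u' : L2I} (h : IsWeakDeriv u u') {a b x : ℝ} (ha : 0 ≤ a)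
    (hb : b ≤ 1) (hab : a < b) (hx : x ∈ Icc a b) :
    ‖repL (u, u') x‖ ≤ (Real.sqrt (b - a))⁻¹ * ‖u‖ + Real.sqrt (b - a) * ‖u'‖ := by
  set r := repL (u, u') with hr
  have hsub : Icc a b ⊆ Icc 0 1 := Icc_subset_Icc ha hb
  have hvol : μI.real (Icc a b) = b - a := by
    rw [Measure.real, Measure.restrict_apply measurableSet_Icc, inter_eq_self_of_subset_left hsub,
      Real.volume_Icc, ENNReal.toReal_ofReal (by linarith)]
  have hint : Integrable r μI := by
    refine (integrable_L2I u).congr ?_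
    rw [← (incl_eq_iff r u)]
    exact h.incl_repL
  -- The inequality `‖r x‖ - √(b - a) ‖u'‖ ≤ ‖r y‖` is averaged over `y ∈ [a, b]`; Cauchy–Schwarz
  -- then bounds the integral of `‖u‖`.
  have h1 : ∫ _ in Icc a b, (‖r x‖ - Real.sqrt (b - a) * ‖u'‖) ∂μI ≤
      ∫ y in Icc a b, ‖r y‖ ∂μI := by
    refine setIntegral_mono_on (integrable_const _).integrableOn hint.norm.integrableOn
      measurableSet_Icc fun y hy => ?_
    have := norm_repL_sub_le (u := u) (u' := u') hx hy
    have h2 := norm_sub_norm_le (r x) (r y)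
    linarith
  have h2 : ∫ y in Icc a b, ‖r y‖ ∂μI = ∫ y in Icc a b, ‖u y‖ ∂μI := by
    refine integral_congr_ae (ae_restrict_of_ae ?_)
    filter_upwards [(incl_eq_iff r u).1 h.incl_repL] with t ht
    rw [ht]
  rw [setIntegral_const, hvol, smul_eq_mul, h2] at h1
  have h3 := h1.trans (setIntegral_norm_le u hab.le)
  have hs : 0 < Real.sqrt (b - a) := Real.sqrt_pos.2 (by linarith)
  have hss : Real.sqrt (b - a) * Real.sqrt (b - a) = b - a := Real.mul_self_sqrt (by linarith)
  have h4 : Real.sqrt (b - a) * (‖r x‖ - Real.sqrt (b - a) * ‖u'‖) ≤ ‖u‖ := by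
    refine le_of_mul_le_mul_left ?_ hs
    rw [← mul_assoc, hss]
    exact h3
  rw [← le_inv_mul_iff₀ hs] at h4
  linarith

lemma IsWeakDeriv.norm_repL_le_one {u u' : L2I} (h : IsWeakDeriv u u') {x : ℝ}
    (hx : x ∈ Icc (0 : ℝ) 1) : ‖repL (u, u') x‖ ≤ ‖u‖ + ‖u'‖ := by
  simpa using h.norm_repL_le le_rfl le_rfl zero_lt_one hx

lemma IsWeakDeriv.supE_le {u u' : L2I} (h : IsWeakDeriv u u') : supE u ≤ ‖u‖ₑ + ‖u'‖ₑ := by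
  rw [supE, eLpNorm_exponent_top]
  have : ∀ᵐ t ∂μI, ‖u t‖ₑ ≤ ‖u‖ₑ + ‖u'‖ₑ := by
    filter_upwards [(incl_eq_iff _ u).1 h.incl_repL, ae_restrict_mem measurableSet_Icc] with t h1 ht
    rw [h1, ← ofReal_norm, ← ofReal_norm, ← ofReal_norm,
      ← ENNReal.ofReal_add (norm_nonneg _) (norm_nonneg _)]
    exact ENNReal.ofReal_le_ofReal (h.norm_repL_le_one ht)
  exact essSup_le_of_ae_le _ this

/-! ### The spaces `H^n[0,1]` -/

namespace Sobolev

variable {n : ℕ}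

/-- `u ↦ D^p u` as a continuous linear map. -/
def DL (p : Fin (n + 1)) : Sobolev n →L[ℂ] L2I :=
  (PiLp.proj 2 (fun _ : Fin (n + 1) => L2I) p).comp (sobolevSubmodule n).subtypeL

lemma isWeakDeriv (u : Sobolev n) (j : Fin n) : IsWeakDeriv (u.D j.castSucc) (u.D j.succ) :=
  u.2 j

lemma ext_D {u v : Sobolev n} (h : ∀ p, u.D p = v.D p) : u = v := by
  apply Subtype.ext
  ext1 p
  exact h p

/-- By uniqueness of weak derivatives the first entry determines the tuple. Elements built in
different ways are identified through this. -/
lemma ext_zero {u v : Sobolev n} (h : u.D 0 = v.D 0) : u = v := by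
  refine ext_D fun p => ?_
  induction p using Fin.induction with
  | zero => exact h
  | succ j hj => exact (u.isWeakDeriv j).unique (hj ▸ v.isWeakDeriv j)

/-- The continuous representative of `u ∈ H^{n+1}[0,1]`, extended to `ℝ`. -/
def rep : Sobolev (n + 1) →L[ℂ] (ℝ →ᵇ ℂ) := repL ∘L (DL 0).prod (DL 1)

lemma rep_apply (u : Sobolev (n + 1)) : rep u = repL (u.D 0, u.D 1) := rfl

lemma isWeakDeriv_zero_one (u : Sobolev (n + 1)) : IsWeakDeriv (u.D 0) (u.D 1) :=
  u.isWeakDeriv 0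

lemma incl_rep (u : Sobolev (n + 1)) : incl (rep u) = u.D 0 := u.isWeakDeriv_zero_one.incl_repL

/-- The choice made in `val` is harmless: two functions continuous on `[0,1]` that agree almost
everywhere agree at every point of `[0,1]`. -/
lemma val_eq_of_ae {u : Sobolev n} {f : ℝ →ᵇ ℂ} (h : u.D 0 = incl f) {t : ℝ}
    (ht : t ∈ Icc (0 : ℝ) 1) : u.val t = f t := by
  have hae : u.D 0 =ᵐ[volume.restrict (Icc (0 : ℝ) 1)] f := (incl_eq_iff _ _).1 h.symm
  have hex : ∃ v : ℝ → ℂ, ContinuousOn v (Icc 0 1) ∧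
      u.D 0 =ᵐ[volume.restrict (Icc (0 : ℝ) 1)] v := ⟨f, f.continuous.continuousOn, hae⟩
  rw [val, dif_pos hex]
  exact Measure.eqOn_Icc_of_ae_eq (μ := volume) zero_ne_one (hex.choose_spec.2.symm.trans hae)
    hex.choose_spec.1 f.continuous.continuousOn ht

lemma val_eq_rep (u : Sobolev (n + 1)) {t : ℝ} (ht : t ∈ Icc (0 : ℝ) 1) : u.val t = rep u t :=
  val_eq_of_ae u.incl_rep.symm ht

lemma ext_val {u v : Sobolev (n + 1)} (h : ∀ t ∈ Icc (0 : ℝ) 1, u.val t = v.val t) : u = v := by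
  apply ext_zero
  rw [← incl_rep, ← incl_rep]
  refine incl_congr fun t ht => ?_
  rw [← val_eq_rep u ht, ← val_eq_rep v ht, h t ht]

/-- Evaluation at `t ∈ [0,1]`. -/
def ev (t : ℝ) : Sobolev (n + 1) →L[ℂ] ℂ := evB t ∘L rep

lemma ev_apply (u : Sobolev (n + 1)) {t : ℝ} (ht : t ∈ Icc (0 : ℝ) 1) : ev t u = u.val t :=
  (val_eq_rep u ht).symm

lemma norm_D_le (u : Sobolev n) (p : Fin (n + 1)) : ‖u.D p‖ ≤ ‖u‖ := by
  refine abs_le_of_sq_le_sq' ?_ (norm_nonneg u) |>.2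
  rw [norm_sq_eq]
  exact Finset.single_le_sum (f := fun p => ‖u.D p‖ ^ 2) (fun _ _ => sq_nonneg _)
    (Finset.mem_univ p)

/-- The derivative `H^{n+1}[0,1] → H^n[0,1]`. -/
def shift : Sobolev (n + 1) →L[ℂ] Sobolev n :=
  LinearMap.mkContinuous
    { toFun := fun u => ⟨WithLp.toLp 2 fun p => u.D p.succ, fun j => u.isWeakDeriv j.succ⟩
      map_add' := fun _ _ => rfl
      map_smul' := fun _ _ => rfl } 1
    fun u => by
      rw [one_mul]
      refine abs_le_of_sq_le_sq' ?_ (norm_nonneg u) |>.2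
      rw [norm_sq_eq, norm_sq_eq, Fin.sum_univ_succ (n := n + 1)]
      exact le_add_of_nonneg_left (sq_nonneg _)

/-- The inclusion `H^{n+1}[0,1] → H^n[0,1]`. -/
def res : Sobolev (n + 1) →L[ℂ] Sobolev n :=
  LinearMap.mkContinuous
    { toFun := fun u => ⟨WithLp.toLp 2 fun p => u.D p.castSucc,
        fun j => u.isWeakDeriv j.castSucc⟩
      map_add' := fun _ _ => rfl
      map_smul' := fun _ _ => rfl } 1
    fun u => by
      rw [one_mul]
      refine abs_le_of_sq_le_sq' ?_ (norm_nonneg u) |>.2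
      rw [norm_sq_eq, norm_sq_eq, Fin.sum_univ_castSucc (n := n + 1)]
      exact le_add_of_nonneg_right (sq_nonneg _)

lemma shift_D (u : Sobolev (n + 1)) (p : Fin (n + 1)) : (shift u).D p = u.D p.succ := rfl

/-- The element of `H^{n+1}[0,1]` with given function and derivative. -/
def cons (u : L2I) (s : Sobolev n) (h : IsWeakDeriv u (s.D 0)) : Sobolev (n + 1) :=
  ⟨WithLp.toLp 2 (Fin.cons u fun p => s.D p), fun j => by
    induction j using Fin.cases with
    | zero => exact h
    | succ j => exact s.isWeakDeriv j⟩

lemma cons_D_zero (u : L2I) (s : Sobolev n) (h : IsWeakDeriv u (s.D 0)) :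
    (cons u s h).D 0 = u := rfl

lemma shift_cons (u : L2I) (s : Sobolev n) (h : IsWeakDeriv u (s.D 0)) :
    shift (cons u s h) = s := rfl

lemma res_val (u : Sobolev (n + 2)) {t : ℝ} (ht : t ∈ Icc (0 : ℝ) 1) : (res u).val t = u.val t := by
  rw [val_eq_rep u ht]
  exact val_eq_of_ae u.incl_rep.symm ht

/-- With two weak derivatives, `u'` has a continuous representative, so `u` is a constant plus the
integral of a continuous function and the fundamental theorem of calculus applies. -/
lemma hasDerivWithinAt_val (u : Sobolev (n + 2)) {t : ℝ} (ht : t ∈ Icc (0 : ℝ) 1) :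
    HasDerivWithinAt u.val ((shift u).val t) (Icc 0 1) t := by
  have h1 : EqOn u.val
      (fun s => meanL (u.D 0 - incl (primL (u.D 1))) + ∫ r in (0 : ℝ)..s, rep (shift u) r)
      (Icc 0 1) := by
    intro s hs
    beta_reduce
    rw [val_eq_rep u hs, rep_apply, repL_apply, ← primL_incl _ hs, incl_rep]
    rfl
  have hc := (rep (shift u)).continuous
  have h2 : HasDerivAt (fun s => meanL (u.D 0 - incl (primL (u.D 1))) +
      ∫ r in (0 : ℝ)..s, rep (shift u) r) (rep (shift u) t) t :=
    (intervalIntegral.integral_hasDerivAt_right (hc.intervalIntegrable _ _)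
      (hc.stronglyMeasurableAtFilter _ _) hc.continuousAt).const_add _
  rw [val_eq_rep _ ht]
  exact h2.hasDerivWithinAt.congr h1 (h1 ht)

end Sobolev

/-! ### Inequalities for sequences -/

lemma ennreal_add_sq_le (x y : ℝ≥0∞) : (x + y) ^ 2 ≤ 2 * (x ^ 2 + y ^ 2) := by
  have h := ENNReal.rpow_add_le_mul_rpow_add_rpow x y (p := 2) (by norm_num)
  have e : (2 : ℝ≥0∞) ^ ((2 : ℝ) - 1) = 2 := by norm_num
  rw [e] at h
  exact_mod_cast h

lemma tsum_mul_sq_le {ι : Type*} (f g : ι → ℝ≥0∞) :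
    (∑' i, f i * g i) ^ 2 ≤ (∑' i, f i ^ 2) * ∑' i, g i ^ 2 := by
  let _ : MeasurableSpace ι := ⊤
  have h := ENNReal.lintegral_mul_le_Lp_mul_Lq (Measure.count : Measure ι)
    Real.HolderConjugate.two_two (f := f) (g := g) (measurable_from_top.aemeasurable)
    (measurable_from_top.aemeasurable)
  rw [lintegral_count, lintegral_count, lintegral_count] at h
  have h2 := pow_le_pow_left' h 2
  have e : ∀ x : ℝ≥0∞, (x ^ (1 / 2 : ℝ)) ^ 2 = x := fun x => by
    rw [← ENNReal.rpow_natCast, ← ENNReal.rpow_mul]; norm_num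
  rw [mul_pow, e, e] at h2
  simpa using h2

/-- The squared norm of `ℓ²`. -/
def l2 (a : ℤ → ℝ≥0∞) : ℝ≥0∞ := ∑' k, a k ^ 2

lemma l2_mono {a b : ℤ → ℝ≥0∞} (h : ∀ k, a k ≤ b k) : l2 a ≤ l2 b :=
  ENNReal.tsum_le_tsum fun k => pow_le_pow_left' (h k) 2

lemma l2_add_le (a b : ℤ → ℝ≥0∞) : l2 (fun k => a k + b k) ≤ 2 * (l2 a + l2 b) := by
  rw [l2, l2, l2, ← ENNReal.tsum_add, ← ENNReal.tsum_mul_left]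
  exact ENNReal.tsum_le_tsum fun k => ennreal_add_sq_le _ _

/-- Young's inequality `ℓ¹ * ℓ² ⊆ ℓ²`. -/
lemma l2_conv_le (a b : ℤ → ℝ≥0∞) :
    l2 (fun k => ∑' j, a j * b (k - j)) ≤ (∑' k, a k) ^ 2 * l2 b := by
  have e : ∀ x : ℝ≥0∞, (x ^ (1 / 2 : ℝ)) ^ 2 = x := fun x => by
    rw [← ENNReal.rpow_natCast, ← ENNReal.rpow_mul]; norm_num
  have h1 : ∀ k, (∑' j, a j * b (k - j)) ^ 2 ≤ (∑' j, a j) * ∑' j, a j * b (k - j) ^ 2 := by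
    intro k
    -- Cauchy–Schwarz after splitting `a j` into two square roots.
    have := tsum_mul_sq_le (fun j => a j ^ (1 / 2 : ℝ)) (fun j => a j ^ (1 / 2 : ℝ) * b (k - j))
    simpa only [← mul_assoc, ← pow_two, mul_pow, e] using this
  refine (ENNReal.tsum_le_tsum h1).trans ?_
  rw [ENNReal.tsum_mul_left, ENNReal.tsum_comm, pow_two, mul_assoc]
  refine mul_le_mul_right (le_of_eq ?_) _
  rw [← ENNReal.tsum_mul_right]
  refine tsum_congr fun j => ?_
  rw [ENNReal.tsum_mul_left]
  congr 1
  exact (Equiv.subRight j).tsum_eq fun k => b k ^ 2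

lemma l2_conv_le' (a b : ℤ → ℝ≥0∞) :
    l2 (fun k => ∑' j, a j * b (k - j)) ≤ l2 a * (∑' k, b k) ^ 2 := by
  have h := l2_conv_le b a
  rw [mul_comm]
  refine le_trans (le_of_eq ?_) h
  congr 1
  funext k
  rw [← (Equiv.subLeft k).tsum_eq fun j => a j * b (k - j)]
  refine tsum_congr fun j => ?_
  simp [mul_comm]

/-- The constant in the embedding of weighted `ℓ²` into `ℓ¹`. -/
def cK : ℝ≥0∞ := ∑' k : ℤ, ((1 + ‖(k : ℂ)‖ₑ)⁻¹) ^ 2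

lemma cK_ne_top : cK ≠ ⊤ := by
  have h : Summable fun k : ℤ => ((1 + |(k : ℝ)|)⁻¹) ^ 2 := by
    have hn : Summable fun n : ℕ => ((1 + (n : ℝ))⁻¹) ^ 2 := by
      have := (summable_nat_add_iff 1).2 (Real.summable_nat_pow_inv.2 one_lt_two)
      refine this.congr fun n => ?_
      push_cast
      rw [inv_pow, add_comm]
    refine Summable.of_nat_of_neg ?_ ?_ <;> simpa using hn
  have e : ∀ k : ℤ, ((1 + ‖(k : ℂ)‖ₑ)⁻¹) ^ 2 = ENNReal.ofReal (((1 + |(k : ℝ)|)⁻¹) ^ 2) := by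
    intro k
    rw [ENNReal.ofReal_pow (by positivity), ENNReal.ofReal_inv_of_pos (by positivity),
      ENNReal.ofReal_add zero_le_one (abs_nonneg _), ENNReal.ofReal_one, ← ofReal_norm,
      Complex.norm_intCast]
  rw [cK, tsum_congr e]
  exact h.tsum_ofReal_ne_top

/-- Cauchy–Schwarz against the square summable sequence `(1 + |k|)⁻¹`: one factor of `k` buys `ℓ¹`
from `ℓ²`. -/
lemma tsum_sq_le (a : ℤ → ℝ≥0∞) :
    (∑' k, a k) ^ 2 ≤ cK * (2 * (l2 a + l2 fun k => ‖(k : ℂ)‖ₑ * a k)) := by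
  have h := tsum_mul_sq_le (fun k : ℤ => (1 + ‖(k : ℂ)‖ₑ)⁻¹)
    (fun k : ℤ => a k + ‖(k : ℂ)‖ₑ * a k)
  have e : ∀ k : ℤ, (1 + ‖(k : ℂ)‖ₑ)⁻¹ * (a k + ‖(k : ℂ)‖ₑ * a k) = a k := by
    intro k
    rw [← one_add_mul, ← mul_assoc, ENNReal.inv_mul_cancel (by simp) (by simp), one_mul]
  simp only [e] at h
  exact h.trans (mul_le_mul_right (l2_add_le _ _) _)

/-! ### Weighted sequences of functions -/

section WeightedSequences

variable (σ : ℝ)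

/-- The weight `e^{σ|k|}`. -/
def expW (k : ℤ) : ℝ≥0∞ := ENNReal.ofReal (Real.exp (σ * |(k : ℝ)|))

variable {σ}

/-- The triangle inequality `|k| ≤ |j| + |k - j|`. This lets the exponential weight be distributed
over the two factors of a convolution. -/
lemma expW_le (hσ : 0 ≤ σ) (k j : ℤ) : expW σ k ≤ expW σ j * expW σ (k - j) := by
  rw [expW, expW, expW, ← ENNReal.ofReal_mul (Real.exp_pos _).le, ← Real.exp_add, ← mul_add]
  refine ENNReal.ofReal_le_ofReal (Real.exp_le_exp.2 (mul_le_mul_of_nonneg_left ?_ hσ))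
  have := abs_add_le (j : ℝ) ((k - j : ℤ) : ℝ)
  push_cast at this ⊢
  simpa using this

lemma one_le_expW (hσ : 0 ≤ σ) (k : ℤ) : 1 ≤ expW σ k := by
  rw [expW, ← ENNReal.ofReal_one]
  exact ENNReal.ofReal_le_ofReal (Real.one_le_exp (by positivity))

variable (σ)

/-- The weighted `L²` norms of the terms. -/
def wL2 (u : ℤ → L2I) (k : ℤ) : ℝ≥0∞ := expW σ k * ‖u k‖ₑ

/-- The weighted sup norms of the terms. -/
def wSup (u : ℤ → L2I) (k : ℤ) : ℝ≥0∞ := expW σ k * supE (u k)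

/-- `InY σ n u R` says that the function with partial Fourier coefficients `u` belongs to
`Y_σ^n`, with a bound on its squared norm in terms of `R`. -/
def InY : ℕ → (ℤ → L2I) → ℝ≥0∞ → Prop
  | 0, u, R => l2 (wL2 σ u) ≤ R
  | n + 1, u, R => l2 (wL2 σ u) ≤ R ∧ InY n (fun k => (k : ℂ) • u k) R ∧
      ∃ u', (∀ k, IsWeakDeriv (u k) (u' k)) ∧ InY n u' R

variable {σ}

lemma InY.l2_le {n : ℕ} {u : ℤ → L2I} {R : ℝ≥0∞} (h : InY σ n u R) : l2 (wL2 σ u) ≤ R := by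
  cases n with
  | zero => exact h
  | succ n => exact h.1

lemma InY.mono {n : ℕ} {u : ℤ → L2I} {R S : ℝ≥0∞} (h : InY σ n u R) (hRS : R ≤ S) :
    InY σ n u S := by
  induction n generalizing u with
  | zero => exact le_trans (show l2 (wL2 σ u) ≤ R from h) hRS
  | succ n ih =>
    obtain ⟨h1, h2, u', h3, h4⟩ := h
    exact ⟨h1.trans hRS, ih h2, u', h3, ih h4⟩

lemma InY.of_succ {n : ℕ} {u : ℤ → L2I} {R : ℝ≥0∞} (h : InY σ (n + 1) u R) : InY σ n u R := by
  induction n generalizing u with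
  | zero => exact h.l2_le
  | succ n ih =>
    obtain ⟨h1, h2, u', h3, h4⟩ := h
    exact ⟨h1, ih h2, u', h3, ih h4⟩

lemma InY.of_le {n m : ℕ} {u : ℤ → L2I} {R : ℝ≥0∞} (h : InY σ n u R) (hmn : m ≤ n) :
    InY σ m u R := by
  induction n, hmn using Nat.le_induction with
  | base => exact h
  | succ n _ ih => exact ih h.of_succ

lemma InY.add {n : ℕ} {u v : ℤ → L2I} {R S : ℝ≥0∞} (hu : InY σ n u R) (hv : InY σ n v S) :
    InY σ n (fun k => u k + v k) (2 * (R + S)) := by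
  have key : ∀ {u v : ℤ → L2I}, l2 (wL2 σ u) ≤ R → l2 (wL2 σ v) ≤ S →
      l2 (wL2 σ fun k => u k + v k) ≤ 2 * (R + S) := by
    intro u v h1 h2
    refine (l2_mono (b := fun k => wL2 σ u k + wL2 σ v k) fun k => ?_).trans
      ((l2_add_le _ _).trans (by gcongr))
    rw [wL2, wL2, wL2, ← mul_add]
    gcongr
    exact enorm_add_le _ _
  induction n generalizing u v with
  | zero => exact key hu hv
  | succ n ih =>
    obtain ⟨h1, h2, u', h3, h4⟩ := hu
    obtain ⟨k1, k2, v', k3, k4⟩ := hv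
    refine ⟨key h1 k1, ?_, fun k => u' k + v' k, fun k => (h3 k).add (k3 k), ih h4 k4⟩
    simpa only [smul_add] using ih h2 k2

lemma wL2_smul (u : ℤ → L2I) (k : ℤ) :
    wL2 σ (fun k => (k : ℂ) • u k) k = ‖(k : ℂ)‖ₑ * wL2 σ u k := by
  rw [wL2, wL2, enorm_smul, mul_left_comm]

/-- Spends one derivative in `x`, that is, one factor `k`. -/
lemma InY.tsum_wL2_le {n : ℕ} {u : ℤ → L2I} {R : ℝ≥0∞} (h : InY σ (n + 1) u R) :
    (∑' k, wL2 σ u k) ^ 2 ≤ 4 * cK * R := by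
  refine (tsum_sq_le _).trans ?_
  have h2 := h.2.1.l2_le
  simp only [l2, wL2_smul] at h2
  calc cK * (2 * (l2 (wL2 σ u) + l2 fun k => ‖(k : ℂ)‖ₑ * wL2 σ u k))
      ≤ cK * (2 * (R + R)) := by
        gcongr
        · exact h.l2_le
        · exact h2
    _ = 4 * cK * R := by ring

lemma wSup_le {u u' : ℤ → L2I} (h : ∀ k, IsWeakDeriv (u k) (u' k)) (k : ℤ) :
    wSup σ u k ≤ wL2 σ u k + wL2 σ u' k := by
  rw [wSup, wL2, wL2, ← mul_add]
  exact mul_le_mul_right (h k).supE_le _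

/-- Spends one derivative in `ψ`, by the embedding of `H¹[0,1]` in bounded functions. -/
lemma InY.l2_wSup_le {n : ℕ} {u : ℤ → L2I} {R : ℝ≥0∞} (h : InY σ (n + 1) u R) :
    l2 (wSup σ u) ≤ 4 * R := by
  obtain ⟨h1, -, u', h3, h4⟩ := h
  calc l2 (wSup σ u) ≤ 2 * (l2 (wL2 σ u) + l2 (wL2 σ u')) :=
        (l2_mono (wSup_le h3)).trans (l2_add_le _ _)
    _ ≤ 2 * (R + R) := by
        gcongr
        exact h4.l2_le
    _ = 4 * R := by ring

/-- Spends one derivative in each variable: sup norms are bounded by `L²` norms of `u` and `u'`,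
both of which still have a derivative in `x` left. -/
lemma InY.tsum_wSup_le {n : ℕ} {u : ℤ → L2I} {R : ℝ≥0∞} (h : InY σ (n + 2) u R) :
    (∑' k, wSup σ u k) ^ 2 ≤ 16 * cK * R := by
  obtain ⟨u', h3, h4⟩ := h.2.2
  calc (∑' k, wSup σ u k) ^ 2 ≤ (∑' k, wL2 σ u k + ∑' k, wL2 σ u' k) ^ 2 := by
        rw [← ENNReal.tsum_add]
        exact pow_le_pow_left' (ENNReal.tsum_le_tsum (wSup_le h3)) 2
    _ ≤ 2 * ((∑' k, wL2 σ u k) ^ 2 + (∑' k, wL2 σ u' k) ^ 2) := ennreal_add_sq_le _ _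
    _ ≤ 2 * (4 * cK * R + 4 * cK * R) := by
        gcongr
        · exact h.of_succ.tsum_wL2_le
        · exact h4.tsum_wL2_le
    _ = 16 * cK * R := by ring

/-! ### Convolution -/

/-- The partial Fourier coefficients of a product. -/
def conv (u v : ℤ → L2I) (k : ℤ) : L2I := ∑' j, mulL2 (u j) (v (k - j))

/-- The sum of the norms of the terms of `conv u v k`. -/
def absConv (u v : ℤ → L2I) (k : ℤ) : ℝ≥0∞ := ∑' j, ‖mulL2 (u j) (v (k - j))‖ₑ

lemma enorm_conv_le (u v : ℤ → L2I) (k : ℤ) : ‖conv u v k‖ₑ ≤ absConv u v k := by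
  by_cases h : absConv u v k = ⊤
  · rw [h]; exact le_top
  · have hs : Summable fun j => ‖mulL2 (u j) (v (k - j))‖₊ :=
      ENNReal.tsum_coe_ne_top_iff_summable.1 h
    have h1 := nnnorm_tsum_le hs
    calc ‖conv u v k‖ₑ = ((‖conv u v k‖₊ : NNReal) : ℝ≥0∞) := rfl
      _ ≤ ((∑' j, ‖mulL2 (u j) (v (k - j))‖₊ : NNReal) : ℝ≥0∞) := ENNReal.coe_le_coe.2 h1
      _ = absConv u v k := ENNReal.coe_tsum hs

lemma l2_absConv_le_left (hσ : 0 ≤ σ) (u v : ℤ → L2I) : l2 (fun k => expW σ k * absConv u v k) ≤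
    l2 (fun k => ∑' j, wSup σ u j * wL2 σ v (k - j)) := by
  refine l2_mono fun k => ?_
  rw [absConv, ← ENNReal.tsum_mul_left]
  refine ENNReal.tsum_le_tsum fun j => ?_
  calc expW σ k * ‖mulL2 (u j) (v (k - j))‖ₑ
      ≤ (expW σ j * expW σ (k - j)) * (supE (u j) * ‖v (k - j)‖ₑ) :=
        mul_le_mul' (expW_le hσ k j) (enorm_mulL2_le_left _ _)
    _ = wSup σ u j * wL2 σ v (k - j) := mul_mul_mul_comm _ _ _ _

lemma l2_absConv_le_right (hσ : 0 ≤ σ) (u v : ℤ → L2I) :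
    l2 (fun k => expW σ k * absConv u v k) ≤
    l2 (fun k => ∑' j, wL2 σ u j * wSup σ v (k - j)) := by
  refine l2_mono fun k => ?_
  rw [absConv, ← ENNReal.tsum_mul_left]
  refine ENNReal.tsum_le_tsum fun j => ?_
  calc expW σ k * ‖mulL2 (u j) (v (k - j))‖ₑ
      ≤ (expW σ j * expW σ (k - j)) * (‖u j‖ₑ * supE (v (k - j))) :=
        mul_le_mul' (expW_le hσ k j) (enorm_mulL2_le_right _ _)
    _ = wL2 σ u j * wSup σ v (k - j) := mul_mul_mul_comm _ _ _ _

/-- A factor with two derivatives has sup norms in weighted `ℓ¹`, and Young's inequality convolves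
it with the `ℓ²` sequence of `L²` norms of the other. -/
lemma InY.l2_absConv_le (hσ : 0 ≤ σ) {a b : ℕ} (hab : 2 ≤ a + b) {u v : ℤ → L2I} {R S : ℝ≥0∞}
    (hu : InY σ a u R) (hv : InY σ b v S) :
    l2 (fun k => expW σ k * absConv u v k) ≤ 16 * cK * R * S := by
  rcases le_or_gt 2 a with ha | ha
  · refine (l2_absConv_le_left hσ u v).trans ((l2_conv_le _ _).trans ?_)
    exact mul_le_mul' (hu.of_le (m := 0 + 2) ha).tsum_wSup_le hv.l2_le
  rcases le_or_gt 2 b with hb | hb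
  · refine (l2_absConv_le_right hσ u v).trans ((l2_conv_le' _ _).trans ?_)
    refine (mul_le_mul' hu.l2_le (hv.of_le (m := 0 + 2) hb).tsum_wSup_le).trans (le_of_eq ?_)
    ring
  -- With one derivative on each factor, `u` spends its own on `ψ` (sup norms in `ℓ²`) and `v`
  -- spends its own on `x` (`L²` norms in `ℓ¹`).
  · obtain rfl : a = 0 + 1 := by omega
    obtain rfl : b = 0 + 1 := by omega
    refine (l2_absConv_le_left hσ u v).trans ((l2_conv_le' _ _).trans ?_)
    refine (mul_le_mul' hu.l2_wSup_le hv.tsum_wL2_le).trans (le_of_eq ?_)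
    ring

lemma InY.l2_conv_le (hσ : 0 ≤ σ) {a b : ℕ} (hab : 2 ≤ a + b) {u v : ℤ → L2I} {R S : ℝ≥0∞}
    (hu : InY σ a u R) (hv : InY σ b v S) : l2 (wL2 σ (conv u v)) ≤ 16 * cK * R * S :=
  (l2_mono fun k => mul_le_mul_right (enorm_conv_le u v k) _).trans (hu.l2_absConv_le hσ hab hv)

lemma InY.hasSum_conv (hσ : 0 ≤ σ) {a b : ℕ} (hab : 2 ≤ a + b) {u v : ℤ → L2I} {R S : ℝ≥0∞}
    (hR : R ≠ ⊤) (hS : S ≠ ⊤) (hu : InY σ a u R) (hv : InY σ b v S) (k : ℤ) :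
    HasSum (fun j => FlowLines.mulL2 (u j) (v (k - j))) (conv u v k) := by
  have h := hu.l2_absConv_le hσ hab hv
  have htop : 16 * cK * R * S ≠ ⊤ := ENNReal.mul_ne_top (ENNReal.mul_ne_top
    (ENNReal.mul_ne_top (by norm_num) cK_ne_top) hR) hS
  have h1 : (expW σ k * absConv u v k) ^ 2 ≠ ⊤ :=
    ((ENNReal.le_tsum k).trans h).trans_lt htop.lt_top |>.ne
  have h2 : absConv u v k ≠ ⊤ := by
    intro h0
    rw [h0, ENNReal.mul_top (zero_lt_one.trans_le (one_le_expW hσ k)).ne'] at h1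
    simp at h1
  have hs : Summable fun j => ‖FlowLines.mulL2 (u j) (v (k - j))‖₊ :=
    ENNReal.tsum_coe_ne_top_iff_summable.1 h2
  exact hs.of_nnnorm.hasSum

/-- Products in the scale `Y_σ^n`. -/
theorem exists_inY_conv (hσ : 0 ≤ σ) (c : ℕ) : ∀ a b : ℕ, c ≤ a → c ≤ b → c + 2 ≤ a + b →
    ∃ C : ℝ≥0∞, C ≠ ⊤ ∧ ∀ (u v : ℤ → L2I) (R S : ℝ≥0∞), R ≠ ⊤ → S ≠ ⊤ →
      InY σ a u R → InY σ b v S → InY σ c (conv u v) (C * R * S) := by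
  induction c with
  | zero =>
    intro a b _ _ hab
    exact ⟨16 * cK, ENNReal.mul_ne_top (by norm_num) cK_ne_top,
      fun u v R S _ _ hu hv => hu.l2_conv_le hσ (by omega) hv⟩
  | succ c ih =>
    intro a b hca hcb hab
    obtain ⟨a, rfl⟩ : ∃ a', a = a' + 1 := ⟨a - 1, by omega⟩
    obtain ⟨b, rfl⟩ : ∃ b', b = b' + 1 := ⟨b - 1, by omega⟩
    -- A derivative falls on one of the two factors, and both resulting pairs of regularities meet
    -- the requirements for order `c`.
    obtain ⟨C1, hC1, h1⟩ := ih a (b + 1) (by omega) (by omega) (by omega)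
    obtain ⟨C2, hC2, h2⟩ := ih (a + 1) b (by omega) (by omega) (by omega)
    refine ⟨16 * cK + 2 * (C1 + C2), ?_, fun u v R S hR hS hu hv => ?_⟩
    · exact ENNReal.add_ne_top.2 ⟨ENNReal.mul_ne_top (by norm_num) cK_ne_top,
        ENNReal.mul_ne_top (by norm_num) (ENNReal.add_ne_top.2 ⟨hC1, hC2⟩)⟩
    have hle : 2 * (C1 * R * S + C2 * R * S) ≤ (16 * cK + 2 * (C1 + C2)) * R * S := by
      rw [add_mul, add_mul]
      refine le_trans (le_of_eq ?_) le_add_self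
      ring
    refine ⟨?_, ?_, ?_⟩
    · refine (hu.l2_conv_le hσ (by omega) hv).trans ?_
      rw [add_mul, add_mul]
      exact le_self_add
    -- The Leibniz rule in `x`, from `k = j + (k - j)` in each summand.
    · have e : (fun k : ℤ => (k : ℂ) • conv u v k) = fun k =>
          conv (fun j => (j : ℂ) • u j) v k + conv u (fun j => (j : ℂ) • v j) k := by
        funext k
        have s0 := (hu.hasSum_conv hσ (by omega) hR hS hv k).const_smul (k : ℂ)
        have s1 := hu.2.1.hasSum_conv hσ (by omega) hR hS hv k
        have s2 := hu.hasSum_conv hσ (by omega) hR hS hv.2.1 k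
        refine s0.unique ?_
        convert s1.add s2 using 1
        funext j
        rw [mulL2_smul_left, mulL2_smul_right, ← add_smul]
        push_cast
        rw [add_sub_cancel]
      rw [e]
      exact ((h1 _ _ R S hR hS hu.2.1 hv).add (h2 _ _ R S hR hS hu hv.2.1)).mono hle
    · obtain ⟨u', hu', hu''⟩ := hu.2.2
      obtain ⟨v', hv', hv''⟩ := hv.2.2
      refine ⟨fun k => conv u' v k + conv u v' k, fun k => ?_,
        ((h1 _ _ R S hR hS hu'' hv).add (h2 _ _ R S hR hS hu hv'')).mono hle⟩
      -- The Leibniz rule in `ψ` holds for each summand and survives summation, since the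
      -- convolutions of the functions and of the derivatives converge in `L²`.
      exact IsWeakDeriv.hasSum (hu.hasSum_conv hσ (by omega) hR hS hv k)
        ((hu''.hasSum_conv hσ (by omega) hR hS hv k).add
          (hu.hasSum_conv hσ (by omega) hR hS hv'' k))
        fun j => (hu' j).mulL2 (hv' (k - j))

end WeightedSequences

/-! ### Fourier inversion -/

section Inversion

variable {E : Type*} [NormedAddCommGroup E] [InnerProductSpace ℂ E]

/-- The function `x ↦ e^{ikx} c`. -/
def mode (k : ℤ) (c : E) : C(Torus, E) := (fourier k : C(Torus, ℂ)) • ContinuousMap.const Torus c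

lemma mode_apply (k : ℤ) (c : E) (x : Torus) : mode k c x = fourier k x • c := rfl

lemma norm_fourier_apply (k : ℤ) (x : Torus) : ‖fourier k x‖ = 1 := Circle.norm_coe _

lemma norm_mode_le (k : ℤ) (c : E) : ‖mode k c‖ ≤ ‖c‖ :=
  (ContinuousMap.norm_le _ (norm_nonneg c)).2 fun x => by
    rw [mode_apply, norm_smul, norm_fourier_apply, one_mul]

/-- Fourier coefficients as continuous linear maps. -/
def coeffL (k : ℤ) : C(Torus, E) →L[ℂ] E :=
  LinearMap.mkContinuous
    { toFun := fun a => fourierCoeff a k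
      map_add' := fun a b => fourierCoeff_add' a b k
      map_smul' := fun c a => fourierCoeff_smul' c a k } 1
    fun a => by
      rw [one_mul]
      refine (norm_integral_le_of_norm_le_const (C := ‖a‖)
        (Filter.Eventually.of_forall fun x => ?_)).trans (by simp)
      rw [norm_smul, norm_fourier_apply, one_mul]
      exact a.norm_coe_le_norm x

lemma coeffL_apply (k : ℤ) (a : C(Torus, E)) : coeffL k a = fourierCoeff a k := rfl

lemma coeffL_mode [CompleteSpace E] (j k : ℤ) (c : E) :
    coeffL k (mode j c) = if j = k then c else 0 := by
  rw [coeffL_apply]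
  have h : fourierCoeff (mode j c) k = fourierCoeff (fourier j : Torus → ℂ) k • c := by
    simp only [fourierCoeff]
    rw [← integral_smul_const]
    refine integral_congr_ae (Filter.Eventually.of_forall fun x => ?_)
    simp only [mode_apply, smul_smul, smul_eq_mul]
  rw [h, fourierCoeff_fourier]
  by_cases hjk : j = k
  · subst hjk; simp
  · rw [if_neg hjk, Pi.single_eq_of_ne (Ne.symm hjk), zero_smul]

variable [CompleteSpace E]

lemma summable_mode {s : ℤ → E} (hs : Summable fun k => ‖s k‖) : Summable fun k => mode k (s k) :=
  Summable.of_norm_bounded hs fun k => norm_mode_le k (s k)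

lemma coeffL_tsum {s : ℤ → E} (hs : Summable fun k => ‖s k‖) (k : ℤ) :
    coeffL k (∑' j, mode j (s j)) = s k := by
  rw [(coeffL k).map_tsum (summable_mode hs)]
  simp only [coeffL_mode]
  exact tsum_ite_eq k s

/-- The absolutely convergent series has the same Fourier coefficients as `a`, and a continuous
function is determined by its coefficients. -/
lemma hasSum_mode (a : C(Torus, E)) (hs : Summable fun k => ‖fourierCoeff a k‖) :
    HasSum (fun k => mode k (fourierCoeff a k)) a := by
  have h := (summable_mode hs).hasSum
  convert h
  rw [← sub_eq_zero]
  refine eq_zero_of_fourierCoeff _ fun k => ?_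
  rw [← coeffL_apply, map_sub, coeffL_tsum hs, coeffL_apply, sub_self]

lemma hasSum_fourier_smul (a : C(Torus, E)) (hs : Summable fun k => ‖fourierCoeff a k‖)
    (x : Torus) : HasSum (fun k => fourier k x • fourierCoeff a k) (a x) := by
  let L : C(Torus, E) →L[ℂ] E := ContinuousMap.evalCLM ℂ x
  have h : HasSum (fun k => L (mode k (fourierCoeff a k))) (L a) := L.hasSum (hasSum_mode a hs)
  exact h

lemma fourierCoeff_comp {G : Type*} [NormedAddCommGroup G] [InnerProductSpace ℂ G]
    [CompleteSpace G] (L : E →L[ℂ] G) (a : C(Torus, E)) (k : ℤ) :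
    fourierCoeff (fun x => L (a x)) k = L (fourierCoeff a k) := by
  rw [fourierCoeff, fourierCoeff, ← L.integral_comp_comm ((integrable_torus a).fourier_smul (-k))]
  refine integral_congr_ae (Filter.Eventually.of_forall fun t => ?_)
  simp only [map_smul]

end Inversion

/-! ### Summability from exponential weights -/

lemma summable_abs_mul_exp {σ : ℝ} (hσ : 0 < σ) (q : ℕ) :
    Summable fun k : ℤ => |(k : ℝ)| ^ q * Real.exp (-(σ * |(k : ℝ)|)) := by
  have h := Real.summable_pow_mul_exp_neg_nat_mul q hσ
  refine Summable.of_nat_of_neg ?_ ?_ <;> simpa using h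

/-- The hypothesis gives `b k ≤ √M e^{-σ|k|}`, and for `σ > 0` exponential decay beats every power.
Uniform convergence and termwise differentiation in `x` rest on this. -/
lemma summable_abs_mul {σ M : ℝ} (hσ : 0 < σ) {b : ℤ → ℝ} (h0 : ∀ k, 0 ≤ b k)
    (h : ∀ k : ℤ, Real.exp (2 * σ * |(k : ℝ)|) * b k ^ 2 ≤ M) (q : ℕ) :
    Summable fun k : ℤ => |(k : ℝ)| ^ q * b k := by
  refine Summable.of_nonneg_of_le (fun k => mul_nonneg (by positivity) (h0 k)) (fun k => ?_)
    ((summable_abs_mul_exp hσ q).mul_right (Real.sqrt M))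
  rw [mul_assoc]
  refine mul_le_mul_of_nonneg_left ?_ (by positivity)
  have h1 : Real.exp (σ * |(k : ℝ)|) * b k ≤ Real.sqrt M := by
    refine Real.le_sqrt_of_sq_le ?_
    rw [mul_pow, ← Real.exp_nat_mul]
    refine le_trans (le_of_eq ?_) (h k)
    congr 2
    push_cast
    ring
  rw [Real.exp_neg]
  rw [← inv_mul_le_iff₀ (by positivity), inv_inv]
  exact h1

/-! ### Elements of `Y_σ^n` as sequences -/

section Terms

variable {σ : ℝ} {n : ℕ}

lemma yTerm_eq (k : ℤ) (u : Sobolev n) :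
    yTerm σ n k u = ∑ p : Fin (n + 1), yWeight σ n k p * ‖u.D p‖ ^ 2 := by
  simp only [yTerm, yWeight, Finset.sum_mul]

lemma yTerm_nonneg (k : ℤ) (u : Sobolev n) : 0 ≤ yTerm σ n k u := by
  rw [yTerm_eq]
  exact Finset.sum_nonneg fun p _ => mul_nonneg (yWeight_nonneg _ _ _ _) (sq_nonneg _)

lemma term_nonneg (σ : ℝ) (k : ℤ) (q : ℕ) : 0 ≤ (k : ℝ) ^ (2 * q) * Real.exp (2 * σ * |(k : ℝ)|) := by
  rw [pow_mul]; positivity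

lemma exp_le_yWeight (k : ℤ) (p : Fin (n + 1)) :
    Real.exp (2 * σ * |(k : ℝ)|) ≤ yWeight σ n k p := by
  have := Finset.single_le_sum (f := fun q : ℕ => (k : ℝ) ^ (2 * q) *
    Real.exp (2 * σ * |(k : ℝ)|)) (s := Finset.range (n - p + 1))
    (fun q _ => term_nonneg σ k q) (Finset.mem_range.2 (Nat.succ_pos _) : 0 ∈ _)
  rw [yWeight]
  refine le_trans (le_of_eq ?_) this
  simp

lemma exp_mul_norm_sq_le_yTerm (k : ℤ) (u : Sobolev n) :
    Real.exp (2 * σ * |(k : ℝ)|) * ‖u‖ ^ 2 ≤ yTerm σ n k u := by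
  rw [yTerm_eq, Sobolev.norm_sq_eq, Finset.mul_sum]
  exact Finset.sum_le_sum fun p _ => mul_le_mul_of_nonneg_right (exp_le_yWeight k p) (sq_nonneg _)

lemma yTerm_shift_le (k : ℤ) (u : Sobolev (n + 1)) :
    yTerm σ n k (Sobolev.shift u) ≤ yTerm σ (n + 1) k u := by
  rw [yTerm_eq, yTerm_eq, Fin.sum_univ_succ (n := n + 1)]
  refine le_add_of_nonneg_of_le (mul_nonneg (yWeight_nonneg _ _ _ _) (sq_nonneg _)) (le_of_eq ?_)
  refine Finset.sum_congr rfl fun p _ => ?_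
  rw [Sobolev.shift_D, yWeight, yWeight]
  simp

/-- Multiplication by `k²` raises `q` by one, and order `n + 1` allows one more value of `q` for the
same `p`. Only the term `q = 0` is lost. -/
lemma sq_mul_yWeight_le (k : ℤ) (p : Fin (n + 1)) :
    (k : ℝ) ^ 2 * yWeight σ n k p ≤ yWeight σ (n + 1) k p.castSucc := by
  have e : n + 1 - (p.castSucc : ℕ) + 1 = (n - p + 1) + 1 := by
    have := p.is_le
    simp only [Fin.val_castSucc]
    omega
  rw [yWeight, yWeight, e, Finset.sum_range_succ' _ (n - p + 1), Finset.mul_sum]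
  refine le_add_of_le_of_nonneg (le_of_eq ?_) (term_nonneg σ k 0)
  refine Finset.sum_congr rfl fun q _ => ?_
  ring

lemma sq_mul_yTerm_res_le (k : ℤ) (u : Sobolev (n + 1)) :
    (k : ℝ) ^ 2 * yTerm σ n k (Sobolev.res u) ≤ yTerm σ (n + 1) k u := by
  rw [yTerm_eq, yTerm_eq, Fin.sum_univ_castSucc (n := n + 1), Finset.mul_sum]
  refine le_add_of_le_of_nonneg (Finset.sum_le_sum fun p _ => ?_)
    (mul_nonneg (yWeight_nonneg _ _ _ _) (sq_nonneg _))
  rw [← mul_assoc]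
  exact mul_le_mul_of_nonneg_right (sq_mul_yWeight_le k p) (sq_nonneg _)

lemma yTerm_res_le (k : ℤ) (u : Sobolev (n + 1)) :
    yTerm σ n k (Sobolev.res u) ≤ yTerm σ (n + 1) k u := by
  rw [yTerm_eq, yTerm_eq, Fin.sum_univ_castSucc (n := n + 1)]
  refine le_add_of_le_of_nonneg (Finset.sum_le_sum fun p _ => ?_)
    (mul_nonneg (yWeight_nonneg _ _ _ _) (sq_nonneg _))
  refine mul_le_mul_of_nonneg_right ?_ (sq_nonneg _)
  refine Finset.sum_le_sum_of_subset_of_nonneg (fun q hq => ?_) fun q _ _ => term_nonneg σ k q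
  have := Finset.mem_range.1 hq
  simp only [Finset.mem_range, Fin.val_castSucc]
  omega

lemma yTerm_smul (k : ℤ) (c : ℂ) (u : Sobolev n) :
    yTerm σ n k (c • u) = ‖c‖ ^ 2 * yTerm σ n k u := by
  rw [← yLin_norm, ← yLin_norm, map_smul, norm_smul, mul_pow]

/-- Terms with `p ≥ 1` belong to the `ψ`-derivative, terms with `p = 0` and `q ≥ 1` are controlled
by `k²` times the norm of order `n`, and `p = q = 0` remains. These three pieces match the clauses
of `InY`. -/
lemma yTerm_succ_le (k : ℤ) (u : Sobolev (n + 1)) :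
    yTerm σ (n + 1) k u ≤ Real.exp (2 * σ * |(k : ℝ)|) * ‖u.D 0‖ ^ 2 +
      (k : ℝ) ^ 2 * yTerm σ n k (Sobolev.res u) + yTerm σ n k (Sobolev.shift u) := by
  have h0 : yWeight σ (n + 1) k 0 ≤
      Real.exp (2 * σ * |(k : ℝ)|) + (k : ℝ) ^ 2 * yWeight σ n k 0 := by
    rw [yWeight, yWeight, Fin.val_zero, Fin.val_zero, Nat.sub_zero, Nat.sub_zero,
      Finset.sum_range_succ', Finset.mul_sum, add_comm]
    refine add_le_add (by simp) (le_of_eq (Finset.sum_congr rfl fun q _ => ?_))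
    ring
  have h1 : yWeight σ n k 0 * ‖u.D 0‖ ^ 2 ≤ yTerm σ n k (Sobolev.res u) := by
    rw [yTerm_eq]
    exact Finset.single_le_sum (f := fun p => yWeight σ n k p * ‖(Sobolev.res u).D p‖ ^ 2)
      (fun p _ => mul_nonneg (yWeight_nonneg _ _ _ _) (sq_nonneg _)) (Finset.mem_univ 0)
  have h2 : yTerm σ (n + 1) k u =
      yWeight σ (n + 1) k 0 * ‖u.D 0‖ ^ 2 + yTerm σ n k (Sobolev.shift u) := by
    rw [yTerm_eq, yTerm_eq, Fin.sum_univ_succ (n := n + 1)]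
    congr 1
    refine Finset.sum_congr rfl fun p _ => ?_
    rw [Sobolev.shift_D, yWeight, yWeight]
    simp
  rw [h2]
  have h3 := mul_le_mul_of_nonneg_right h0 (sq_nonneg ‖u.D 0‖)
  have h4 := mul_le_mul_of_nonneg_left h1 (sq_nonneg (k : ℝ))
  linarith

end Terms

section Sequences

variable (σ : ℝ) {n : ℕ}

/-- The squared norm of `Y_σ^n` on sequences of partial Fourier coefficients. -/
def ySum (s : ℤ → Sobolev n) : ℝ≥0∞ := ∑' k, ENNReal.ofReal (yTerm σ n k (s k))

variable {σ}

lemma summable_of_ySum {s : ℤ → Sobolev n} (h : ySum σ s ≠ ⊤) :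
    Summable fun k => yTerm σ n k (s k) := by
  have := ENNReal.summable_toReal h
  exact this.congr fun k => ENNReal.toReal_ofReal (yTerm_nonneg _ _)

lemma ySum_eq {s : ℤ → Sobolev n} (h : Summable fun k => yTerm σ n k (s k)) :
    ySum σ s = ENNReal.ofReal (∑' k, yTerm σ n k (s k)) :=
  (ENNReal.ofReal_tsum_of_nonneg (fun _ => yTerm_nonneg _ _) h).symm

lemma summable_abs_mul_norm (hσ : 0 < σ) {s : ℤ → Sobolev n}
    (h : Summable fun k => yTerm σ n k (s k)) (q : ℕ) :
    Summable fun k : ℤ => |(k : ℝ)| ^ q * ‖s k‖ :=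
  summable_abs_mul hσ (fun _ => norm_nonneg _) (fun k => (exp_mul_norm_sq_le_yTerm k (s k)).trans
    (h.le_tsum k fun _ _ => yTerm_nonneg _ _)) q

lemma summable_norm (hσ : 0 < σ) {s : ℤ → Sobolev n}
    (h : Summable fun k => yTerm σ n k (s k)) : Summable fun k : ℤ => ‖s k‖ := by
  simpa using summable_abs_mul_norm hσ h 0

lemma wL2_sq (u : ℤ → L2I) (k : ℤ) :
    wL2 σ u k ^ 2 = ENNReal.ofReal (Real.exp (2 * σ * |(k : ℝ)|) * ‖u k‖ ^ 2) := by
  rw [wL2, expW, ← ofReal_norm, ← ENNReal.ofReal_mul (Real.exp_pos _).le,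
    ← ENNReal.ofReal_pow (by positivity), mul_pow, ← Real.exp_nat_mul]
  congr 3
  push_cast
  ring

lemma l2_wL2_le_ySum (s : ℤ → Sobolev n) : l2 (wL2 σ fun k => (s k).D 0) ≤ ySum σ s := by
  refine ENNReal.tsum_le_tsum fun k => ?_
  rw [wL2_sq]
  refine ENNReal.ofReal_le_ofReal ((mul_le_mul_of_nonneg_left ?_ (Real.exp_pos _).le).trans
    (exp_mul_norm_sq_le_yTerm k (s k)))
  exact pow_le_pow_left₀ (norm_nonneg _) ((s k).norm_D_le 0) 2

lemma inY_ySum (s : ℤ → Sobolev n) : InY σ n (fun k => (s k).D 0) (ySum σ s) := by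
  induction n with
  | zero => exact l2_wL2_le_ySum s
  | succ n ih =>
    refine ⟨l2_wL2_le_ySum s, ?_, (fun k => (s k).D 1), (fun k => (s k).isWeakDeriv_zero_one), ?_⟩
    · refine (ih fun k => (k : ℂ) • Sobolev.res (s k)).mono (ENNReal.tsum_le_tsum fun k => ?_)
      rw [yTerm_smul, Complex.norm_intCast, sq_abs]
      exact ENNReal.ofReal_le_ofReal (sq_mul_yTerm_res_le k (s k))
    · exact (ih fun k => Sobolev.shift (s k)).mono (ENNReal.tsum_le_tsum fun k =>
        ENNReal.ofReal_le_ofReal (yTerm_shift_le k (s k)))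

/-- Converse of `inY_ySum`: `InY` speaks only of `L²` functions, and the element of `H^{n+1}[0,1]`
is rebuilt by putting `w k` in front of the lift of its derivative. -/
lemma exists_ySum_le_of_inY (n : ℕ) : ∃ C : ℝ≥0∞, C ≠ ⊤ ∧ ∀ (w : ℤ → L2I) (R : ℝ≥0∞), InY σ n w R →
    ∃ s : ℤ → Sobolev n, (∀ k, (s k).D 0 = w k) ∧ ySum σ s ≤ C * R := by
  induction n with
  | zero =>
    refine ⟨1, ENNReal.one_ne_top, fun w R h => ⟨fun k =>
      ⟨WithLp.toLp 2 fun _ => w k, fun j => j.elim0⟩, fun k => rfl, ?_⟩⟩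
    rw [one_mul]
    refine le_trans (ENNReal.tsum_le_tsum fun k => ?_) h
    rw [wL2_sq, yTerm_eq, Fin.sum_univ_one, yWeight]
    simp [Sobolev.D]
  | succ n ih =>
    obtain ⟨C, hC, h⟩ := ih
    refine ⟨1 + 2 * C, by simp [ENNReal.mul_eq_top, hC], fun w R hw => ?_⟩
    obtain ⟨h1, h2, w', h3, h4⟩ := hw
    obtain ⟨s1, e1, b1⟩ := h _ _ h2
    obtain ⟨s2, e2, b2⟩ := h _ _ h4
    have hd : ∀ k, IsWeakDeriv (w k) ((s2 k).D 0) := fun k => (e2 k).symm ▸ h3 k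
    refine ⟨fun k => Sobolev.cons (w k) (s2 k) (hd k), fun k => rfl, ?_⟩
    -- The lift coming from the `x`-clause agrees with the one built from the `ψ`-clause because
    -- both have first entry `k • w k`.
    have e3 : ∀ k : ℤ, (k : ℂ) • Sobolev.res (Sobolev.cons (w k) (s2 k) (hd k)) = s1 k :=
      fun k => Sobolev.ext_zero (e1 k).symm
    calc ySum σ (fun k => Sobolev.cons (w k) (s2 k) (hd k))
        ≤ ∑' k, (wL2 σ w k ^ 2 + ENNReal.ofReal (yTerm σ n k (s1 k)) +
            ENNReal.ofReal (yTerm σ n k (s2 k))) := by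
          refine ENNReal.tsum_le_tsum fun k => ?_
          rw [wL2_sq, ← ENNReal.ofReal_add (by positivity) (yTerm_nonneg _ _),
            ← ENNReal.ofReal_add (add_nonneg (by positivity) (yTerm_nonneg _ _))
              (yTerm_nonneg _ _)]
          refine ENNReal.ofReal_le_ofReal ((yTerm_succ_le k _).trans (le_of_eq ?_))
          rw [← e3 k, yTerm_smul, Complex.norm_intCast, sq_abs, Sobolev.cons_D_zero,
            Sobolev.shift_cons]
      _ = l2 (wL2 σ w) + ySum σ s1 + ySum σ s2 := by
          rw [ENNReal.tsum_add, ENNReal.tsum_add]; rfl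
      _ ≤ R + C * R + C * R := by gcongr
      _ = (1 + 2 * C) * R := by ring

end Sequences

/-! ### Partial Fourier coefficients and completeness of `Y_σ^n` -/

namespace YSpace

variable {σ : ℝ} {n : ℕ}

/-- The partial Fourier coefficients. -/
def coef (a : YSpace σ n) (k : ℤ) : Sobolev n := fourierCoeff a.toFun k

lemma coef_add (a b : YSpace σ n) (k : ℤ) : (a + b).coef k = a.coef k + b.coef k :=
  fourierCoeff_add' a.toFun b.toFun k

lemma coef_smul (c : ℂ) (a : YSpace σ n) (k : ℤ) : (c • a).coef k = c • a.coef k :=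
  fourierCoeff_smul' c a.toFun k

lemma summable_yTerm (a : YSpace σ n) : Summable fun k => yTerm σ n k (a.coef k) := a.2

lemma norm_sq (a : YSpace σ n) : ‖a‖ ^ 2 = ∑' k, yTerm σ n k (a.coef k) :=
  Real.sq_sqrt (tsum_nonneg fun _ => yTerm_nonneg _ _)

lemma ySum_coef (a : YSpace σ n) : ySum σ a.coef = ENNReal.ofReal (‖a‖ ^ 2) := by
  rw [ySum_eq a.summable_yTerm, norm_sq]

lemma ext_coef {a b : YSpace σ n} (h : ∀ k, a.coef k = b.coef k) : a = b := by
  rw [← sub_eq_zero]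
  apply Subtype.ext
  refine eq_zero_of_fourierCoeff _ fun k => ?_
  have : (a - b).coef k = 0 := by
    have h1 := coef_add (a - b) b k
    rw [sub_add_cancel, h k] at h1
    exact left_eq_add.1 (h1.trans (add_comm _ _))
  exact this

lemma exists_coef_eq (hσ : 0 < σ) {s : ℤ → Sobolev n} (h : Summable fun k => yTerm σ n k (s k)) :
    ∃ a : YSpace σ n, ∀ k, a.coef k = s k := by
  have e := coeffL_tsum (summable_norm hσ h)
  refine ⟨⟨∑' k, mode k (s k), ?_⟩, e⟩
  change Summable _
  simp only [← coeffL_apply, e]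
  exact h

lemma hasSum_toFun (hσ : 0 < σ) (a : YSpace σ n) (x : Torus) :
    HasSum (fun k => fourier k x • a.coef k) (a.toFun x) :=
  hasSum_fourier_smul a.toFun (summable_norm hσ a.summable_yTerm) x

/-- `Y_σ^n` as a subspace of an `ℓ²` space. -/
def toLp : YSpace σ n →ₗᵢ[ℂ] lp (fun _ : ℤ => PiLp 2 fun _ : Fin (n + 1) => L2I) 2 where
  toFun a := ⟨fun k => yLin σ n k (a.coef k), (memlp_iff _ _).2 (by
    simp only [yLin_norm]; exact a.summable_yTerm)⟩
  map_add' a b := by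
    ext k : 2
    change yLin σ n k ((a + b).coef k) = yLin σ n k (a.coef k) + yLin σ n k (b.coef k)
    rw [coef_add, map_add]
  map_smul' c a := by
    ext k : 2
    change yLin σ n k ((c • a).coef k) = c • yLin σ n k (a.coef k)
    rw [coef_smul, map_smul]
  norm_map' a := by
    rw [← sq_eq_sq₀ (norm_nonneg _) (norm_nonneg _), norm_sq]
    have := lp.norm_rpow_eq_tsum (p := 2) (E := fun _ : ℤ => PiLp 2 fun _ : Fin (n + 1) => L2I)
      (by norm_num) ⟨fun k => yLin σ n k (a.coef k), (memlp_iff _ _).2 (by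
        simp only [yLin_norm]; exact a.summable_yTerm)⟩
    simp only [← yLin_norm]
    simpa using this

lemma toLp_apply (a : YSpace σ n) (k : ℤ) : toLp a k = yLin σ n k (a.coef k) := rfl

/-- The isometric image in `ℓ²` is closed: it is cut out by the condition that each entry, with the
weights divided out, lies in the closed subspace `sobolevSubmodule n`. Completeness is needed for
the Neumann series. -/
lemma completeSpace (hσ : 0 < σ) : CompleteSpace (YSpace σ n) := by
  rw [completeSpace_iff_isComplete_range
    (toLp (σ := σ) (n := n)).isometry.isUniformInducing]
  refine IsClosed.isComplete ?_
  have hrange : range (toLp (σ := σ) (n := n)) = ⋂ k : ℤ,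
      {f | WithLp.toLp 2 (fun p : Fin (n + 1) => (Real.sqrt (yWeight σ n k p) : ℂ)⁻¹ • f k p) ∈
        sobolevSubmodule n} := by
    have hw : ∀ (k : ℤ) (p : Fin (n + 1)), (Real.sqrt (yWeight σ n k p) : ℂ) ≠ 0 := fun k p =>
      Complex.ofReal_ne_zero.2 (Real.sqrt_pos.2 (yWeight_pos σ n k p)).ne'
    ext f
    rw [mem_iInter]
    constructor
    · rintro ⟨a, rfl⟩ k
      have : WithLp.toLp 2 (fun p : Fin (n + 1) =>
          (Real.sqrt (yWeight σ n k p) : ℂ)⁻¹ • toLp a k p) = (a.coef k).1 := by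
        ext1 p
        rw [toLp_apply]
        change (Real.sqrt (yWeight σ n k p) : ℂ)⁻¹ •
          ((Real.sqrt (yWeight σ n k p) : ℂ) • (a.coef k).D p) = (a.coef k).D p
        rw [inv_smul_smul₀ (hw k p)]
      rw [mem_ofPred_eq, this]
      exact (a.coef k).2
    · intro h
      let s : ℤ → Sobolev n := fun k => ⟨_, h k⟩
      have hs : ∀ k, yLin σ n k (s k) = f k := by
        intro k
        ext1 p
        change (Real.sqrt (yWeight σ n k p) : ℂ) •
          ((Real.sqrt (yWeight σ n k p) : ℂ)⁻¹ • f k p) = f k p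
        rw [smul_inv_smul₀ (hw k p)]
      have hsum : Summable fun k => yTerm σ n k (s k) := by
        simp only [← yLin_norm, hs]
        have := (lp.memℓp f).summable (by norm_num)
        simpa using this
      obtain ⟨a, ha⟩ := exists_coef_eq hσ hsum
      refine ⟨a, ?_⟩
      ext k : 2
      rw [toLp_apply, ha, hs]
  rw [hrange]
  refine isClosed_iInter fun k => (isClosed_sobolevSubmodule n).preimage ?_
  have hk : Continuous fun f : lp (fun _ : ℤ => PiLp 2 fun _ : Fin (n + 1) => L2I) 2 => f k :=
    (lp.lipschitzWith_one_eval 2 k).continuous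
  refine (PiLp.continuous_toLp 2 _).comp (continuous_pi fun p => ?_)
  exact ((PiLp.continuous_apply 2 (fun _ : Fin (n + 1) => L2I) p).comp hk).const_smul
    (Real.sqrt (yWeight σ n k p) : ℂ)⁻¹

end YSpace

namespace YSpace

variable {σ : ℝ} {n m : ℕ}

/-! ### Maps given by their action on partial Fourier coefficients -/

lemma exists_clm (hσ : 0 < σ) {F : Type*} [NormedAddCommGroup F] [NormedSpace ℂ F]
    (L : ℤ → F →ₗ[ℂ] Sobolev n) (C : ℝ) (hC : 0 ≤ C)
    (h : ∀ f, Summable fun k => yTerm σ n k (L k f))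
    (h' : ∀ f, ∑' k, yTerm σ n k (L k f) ≤ (C * ‖f‖) ^ 2) :
    ∃ M : F →L[ℂ] YSpace σ n, ∀ f k, (M f).coef k = L k f := by
  choose M hM using fun f => exists_coef_eq hσ (h f)
  refine ⟨LinearMap.mkContinuous
    { toFun := M
      map_add' := fun f g => ext_coef fun k => by rw [coef_add, hM, hM, hM, map_add]
      map_smul' := fun c f => ext_coef fun k => by
        rw [RingHom.id_apply, coef_smul, hM, hM, map_smul] } C fun f => ?_, hM⟩
  refine abs_le_of_sq_le_sq' ?_ (by positivity) |>.2
  rw [norm_sq]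
  simp only [LinearMap.coe_mk, AddHom.coe_mk, hM]
  exact h' f

/-- `a ↦ â_k` as a linear map. -/
def coefL (k : ℤ) : YSpace σ n →ₗ[ℂ] Sobolev n where
  toFun a := a.coef k
  map_add' a b := coef_add a b k
  map_smul' c a := coef_smul c a k

lemma exists_multiplier (hσ : 0 < σ) (L : ℤ → Sobolev m →ₗ[ℂ] Sobolev n)
    (h : ∀ k u, yTerm σ n k (L k u) ≤ yTerm σ m k u) :
    ∃ M : YSpace σ m →L[ℂ] YSpace σ n, ∀ a k, (M a).coef k = L k (a.coef k) := by
  have hs : ∀ a : YSpace σ m, Summable fun k => yTerm σ n k (L k (a.coef k)) := fun a =>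
    Summable.of_nonneg_of_le (fun k => yTerm_nonneg _ _) (fun k => h k _) a.summable_yTerm
  refine exists_clm hσ (fun k => (L k).comp (coefL k)) 1 zero_le_one hs fun a => ?_
  rw [one_mul, norm_sq]
  exact (hs a).tsum_le_tsum (fun k => h k _) a.summable_yTerm

/-- The derivative in `ψ`. -/
def dψL (hσ : 0 < σ) : YSpace σ (n + 1) →L[ℂ] YSpace σ n :=
  (exists_multiplier hσ (fun _ => (Sobolev.shift (n := n)).toLinearMap) yTerm_shift_le).choose

lemma coef_dψL (hσ : 0 < σ) (a : YSpace σ (n + 1)) (k : ℤ) :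
    (dψL hσ a).coef k = Sobolev.shift (a.coef k) :=
  (exists_multiplier hσ (fun _ => (Sobolev.shift (n := n)).toLinearMap)
    yTerm_shift_le).choose_spec a k

/-- The inclusion `Y_σ^{n+1} ⊆ Y_σ^n`. -/
def resL (hσ : 0 < σ) : YSpace σ (n + 1) →L[ℂ] YSpace σ n :=
  (exists_multiplier hσ (fun _ => (Sobolev.res (n := n)).toLinearMap) yTerm_res_le).choose

lemma coef_resL (hσ : 0 < σ) (a : YSpace σ (n + 1)) (k : ℤ) :
    (resL hσ a).coef k = Sobolev.res (a.coef k) :=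
  (exists_multiplier hσ (fun _ => (Sobolev.res (n := n)).toLinearMap)
    yTerm_res_le).choose_spec a k

lemma exists_dxL (hσ : 0 < σ) : ∃ M : YSpace σ (n + 1) →L[ℂ] YSpace σ n,
    ∀ a k, (M a).coef k = (Complex.I * k) • Sobolev.res (a.coef k) := by
  refine exists_multiplier hσ
    (fun k => (Complex.I * k : ℂ) • (Sobolev.res (n := n)).toLinearMap) fun k u => ?_
  refine le_trans (le_of_eq ?_) (sq_mul_yTerm_res_le k u)
  rw [LinearMap.smul_apply, yTerm_smul, norm_mul, Complex.norm_I, one_mul, Complex.norm_intCast,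
    sq_abs]
  rfl

/-- The derivative in `x`. -/
def dxL (hσ : 0 < σ) : YSpace σ (n + 1) →L[ℂ] YSpace σ n := (exists_dxL hσ).choose

lemma coef_dxL (hσ : 0 < σ) (a : YSpace σ (n + 1)) (k : ℤ) :
    (dxL hσ a).coef k = (Complex.I * k) • Sobolev.res (a.coef k) :=
  (exists_dxL hσ).choose_spec a k

lemma yTerm_zero_eq (u : Sobolev n) : yTerm σ n 0 u = ‖u‖ ^ 2 := by
  rw [yTerm_eq, Sobolev.norm_sq_eq]
  refine Finset.sum_congr rfl fun p _ => ?_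
  -- At `k = 0` only `q = 0` contributes, with `0 ^ 0 = 1`.
  have : yWeight σ n 0 p = 1 := by
    rw [yWeight, Finset.sum_eq_single 0] <;> simp +contextual
  rw [this, one_mul]

lemma exists_constL (hσ : 0 < σ) : ∃ M : Sobolev n →L[ℂ] YSpace σ n,
    ∀ u k, (M u).coef k = if k = 0 then u else 0 := by
  have h0 : ∀ u : Sobolev n, ∀ k : ℤ, k ≠ 0 →
      yTerm σ n k ((if k = 0 then LinearMap.id else 0 : Sobolev n →ₗ[ℂ] Sobolev n) u) = 0 := by
    intro u k hk
    rw [if_neg hk, LinearMap.zero_apply, ← yLin_norm, map_zero]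
    simp
  obtain ⟨M, hM⟩ := exists_clm (σ := σ) hσ
    (fun k => (if k = 0 then LinearMap.id else 0 : Sobolev n →ₗ[ℂ] Sobolev n)) 1 zero_le_one
    (fun u => summable_of_ne_finset_zero (s := {0}) fun k hk => h0 u k (by simpa using hk))
    (fun u => by
      rw [tsum_eq_single 0 (h0 u), if_pos rfl, LinearMap.id_apply, yTerm_zero_eq, one_mul])
  refine ⟨M, fun u k => ?_⟩
  rw [hM]
  split_ifs <;> rfl

/-- Functions of `ψ` as functions on the strip. -/
def constL (hσ : 0 < σ) : Sobolev n →L[ℂ] YSpace σ n := (exists_constL hσ).choose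

lemma coef_constL (hσ : 0 < σ) (u : Sobolev n) (k : ℤ) :
    (constL hσ u).coef k = if k = 0 then u else 0 :=
  (exists_constL hσ).choose_spec u k

/-! ### Values -/

lemma toFun_eq_of_coef (hσ : 0 < σ) (L : Sobolev m →L[ℂ] Sobolev n) {a : YSpace σ m}
    {b : YSpace σ n} (h : ∀ k, b.coef k = L (a.coef k)) (x : Torus) :
    b.toFun x = L (a.toFun x) := by
  refine (hasSum_toFun hσ b x).unique ?_
  convert L.hasSum (hasSum_toFun hσ a x) using 1
  funext k
  rw [h, ← map_smul]

lemma toFun_constL (hσ : 0 < σ) (u : Sobolev n) (x : Torus) : (constL hσ u).toFun x = u := by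
  refine (hasSum_toFun hσ _ x).unique ?_
  have := hasSum_ite_eq (0 : ℤ) u
  convert this using 1
  funext k
  rw [coef_constL]
  split_ifs with hk
  · rw [hk, fourier_zero, one_smul]
  · rw [smul_zero]

lemma val_constL (hσ : 0 < σ) (u : Sobolev n) (x t : ℝ) : (constL hσ u).val x t = u.val t := by
  rw [val, toFun_constL]

lemma hasSum_val (hσ : 0 < σ) (a : YSpace σ (n + 1)) (x : ℝ) {t : ℝ} (ht : t ∈ Icc (0 : ℝ) 1) :
    HasSum (fun k => fourier k (x : Torus) * Sobolev.ev t (a.coef k)) (a.val x t) := by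
  rw [val, ← Sobolev.ev_apply _ ht]
  have := (Sobolev.ev (n := n) t).hasSum (hasSum_toFun hσ a x)
  convert this using 1
  funext k
  simp

lemma val_add (a b : YSpace σ (n + 1)) (x : ℝ) {t : ℝ} (ht : t ∈ Icc (0 : ℝ) 1) :
    (a + b).val x t = a.val x t + b.val x t := by
  simp only [val, ← Sobolev.ev_apply _ ht]
  exact (Sobolev.ev t).map_add (a.toFun x) (b.toFun x)

lemma val_smul (c : ℂ) (a : YSpace σ (n + 1)) (x : ℝ) {t : ℝ} (ht : t ∈ Icc (0 : ℝ) 1) :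
    (c • a).val x t = c * a.val x t := by
  simp only [val, ← Sobolev.ev_apply _ ht]
  exact (Sobolev.ev t).map_smul c (a.toFun x)

lemma ext_val {a b : YSpace σ (n + 1)}
    (h : ∀ x : ℝ, ∀ t ∈ Icc (0 : ℝ) 1, a.val x t = b.val x t) : a = b := by
  apply Subtype.ext
  refine ContinuousMap.ext fun x => ?_
  induction x using QuotientAddGroup.induction_on with
  | H x => exact Sobolev.ext_val (h x)

lemma val_resL (hσ : 0 < σ) (a : YSpace σ (n + 2)) (x : ℝ) {t : ℝ} (ht : t ∈ Icc (0 : ℝ) 1) :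
    (resL hσ a).val x t = a.val x t := by
  rw [val, toFun_eq_of_coef hσ Sobolev.res (coef_resL hσ a), Sobolev.res_val _ ht]; rfl

lemma hasDerivWithinAt_val (hσ : 0 < σ) (a : YSpace σ (n + 2)) (x : ℝ) {t : ℝ}
    (ht : t ∈ Icc (0 : ℝ) 1) :
    HasDerivWithinAt (a.val x) ((dψL hσ a).val x t) (Icc 0 1) t := by
  rw [val, toFun_eq_of_coef hσ Sobolev.shift (coef_dψL hσ a)]
  exact Sobolev.hasDerivWithinAt_val _ ht

/-- The Fourier series is differentiated term by term: the derivatives are dominated, uniformly in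
`x`, by multiples of `|k| ‖â_k‖`, which is summable. -/
lemma hasDerivAt_val (hσ : 0 < σ) (a : YSpace σ (n + 2)) (x : ℝ) {t : ℝ}
    (ht : t ∈ Icc (0 : ℝ) 1) : HasDerivAt (fun y => a.val y t) ((dxL hσ a).val x t) x := by
  have hev : ∀ u : Sobolev (n + 2), Sobolev.ev t (Sobolev.res u) = Sobolev.ev t u := fun u => by
    rw [Sobolev.ev_apply _ ht, Sobolev.ev_apply _ ht, Sobolev.res_val _ ht]
  have hd : ∀ (k : ℤ) (y : ℝ), HasDerivAt
      (fun y : ℝ => fourier k (y : Torus) * Sobolev.ev t (a.coef k))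
      (fourier k (y : Torus) * Sobolev.ev t ((dxL hσ a).coef k)) y := by
    intro k y
    have h1 := (hasDerivAt_fourier (2 * Real.pi) k y).mul_const (Sobolev.ev t (a.coef k))
    refine h1.congr_deriv ?_
    rw [coef_dxL, map_smul, hev, smul_eq_mul]
    have hpi : (Real.pi : ℂ) ≠ 0 := Complex.ofReal_ne_zero.2 Real.pi_ne_zero
    push_cast
    field_simp
  have hb : ∀ (k : ℤ) (y : ℝ), ‖fourier k (y : Torus) * Sobolev.ev t ((dxL hσ a).coef k)‖ ≤
      ‖Sobolev.ev (n := n + 1) t‖ * (|(k : ℝ)| ^ 1 * ‖a.coef k‖) := by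
    intro k y
    rw [coef_dxL, map_smul, hev, norm_mul, norm_fourier_apply, one_mul, norm_smul, norm_mul,
      Complex.norm_I, one_mul, Complex.norm_intCast, pow_one, mul_left_comm]
    exact mul_le_mul_of_nonneg_left (ContinuousLinearMap.le_opNorm _ _) (abs_nonneg _)
  have key := hasDerivAt_tsum ((summable_abs_mul_norm hσ a.summable_yTerm 1).mul_left _) hd hb
    (hasSum_val hσ a 0 ht).summable x
  rw [(hasSum_val hσ (dxL hσ a) x ht).tsum_eq] at key
  have e : (fun y => a.val y t) =
      fun y : ℝ => ∑' k : ℤ, fourier k (y : Torus) * Sobolev.ev t (a.coef k) :=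
    funext fun y => (hasSum_val hσ a y ht).tsum_eq.symm
  rw [e]
  exact key

/-! ### Traces -/

lemma one_add_pow_le (k : ℤ) (j : ℕ) : (1 + (k : ℝ) ^ 2) ^ j ≤
    2 ^ j * ∑ q ∈ Finset.range (j + 1), (k : ℝ) ^ (2 * q) := by
  rw [add_comm, add_pow, Finset.mul_sum]
  refine Finset.sum_le_sum fun q _ => ?_
  rw [one_pow, mul_one, ← pow_mul, mul_comm]
  refine mul_le_mul_of_nonneg_right ?_ (by rw [pow_mul]; positivity)
  exact_mod_cast Nat.choose_le_two_pow _ _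

/-- With `r = 1 + k²`, interpolation at length `r^{-1/2}` gives `r^{n+1/2} |u(t)|² ≤ 2 (r^{n+1} ‖u‖²
+ r^n ‖u'‖²)`. The right side is comparable to the terms `p = 0` and `p = 1` of the norm. -/
lemma xTerm_ev_le (k : ℤ) (u : Sobolev (n + 1)) {t : ℝ} (ht : t ∈ Icc (0 : ℝ) 1) :
    xTerm σ (((n + 1 : ℕ) : ℝ) - 1 / 2) k (Sobolev.ev t u) ≤ 2 ^ (n + 2) * yTerm σ (n + 1) k u := by
  set r : ℝ := 1 + (k : ℝ) ^ 2 with hr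
  have hr1 : 1 ≤ r := by rw [hr]; nlinarith [sq_nonneg (k : ℝ)]
  have hr0 : 0 < r := by linarith
  set d : ℝ := (Real.sqrt r)⁻¹ with hd
  have hsr : 0 < Real.sqrt r := Real.sqrt_pos.2 hr0
  have hd0 : 0 < d := inv_pos.2 hsr
  have hd1 : d ≤ 1 := inv_le_one_of_one_le₀ (Real.one_le_sqrt.2 hr1)
  -- As `d ≤ 1`, an interval of length `d` containing `t` fits in `[0,1]`: it starts at `t`, or ends
  -- at `1` when `t` is too close to `1`.
  obtain ⟨a, b, ha, hb, hab, htab⟩ :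
      ∃ a b : ℝ, 0 ≤ a ∧ b ≤ 1 ∧ b - a = d ∧ t ∈ Icc a b := by
    rcases le_total t (1 - d) with h | h
    · exact ⟨t, t + d, ht.1, by linarith, by ring, le_rfl, by linarith⟩
    · exact ⟨1 - d, 1, by linarith, le_rfl, by ring, h, ht.2⟩
  have h1 := u.isWeakDeriv_zero_one.norm_repL_le ha hb (by linarith) htab
  rw [hab] at h1
  have hsd : 0 < Real.sqrt d := Real.sqrt_pos.2 hd0
  have h2 : ‖Sobolev.ev t u‖ ^ 2 ≤ 2 * (Real.sqrt r * ‖u.D 0‖ ^ 2 + d * ‖u.D 1‖ ^ 2) := by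
    have e1 : ((Real.sqrt d)⁻¹ * ‖u.D 0‖) ^ 2 = Real.sqrt r * ‖u.D 0‖ ^ 2 := by
      rw [mul_pow, inv_pow, Real.sq_sqrt hd0.le, hd, inv_inv]
    have e2 : (Real.sqrt d * ‖u.D 1‖) ^ 2 = d * ‖u.D 1‖ ^ 2 := by
      rw [mul_pow, Real.sq_sqrt hd0.le]
    rw [← e1, ← e2]
    exact (pow_le_pow_left₀ (norm_nonneg _) h1 2).trans add_sq_le
  have p1 : r ^ (((n + 1 : ℕ) : ℝ) - 1 / 2) * Real.sqrt r = r ^ (n + 1) := by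
    rw [Real.sqrt_eq_rpow, ← Real.rpow_add hr0, sub_add_cancel, Real.rpow_natCast]
  have p2 : r ^ (((n + 1 : ℕ) : ℝ) - 1 / 2) * d = r ^ n := by
    rw [hd, Real.sqrt_eq_rpow, ← Real.rpow_neg hr0.le, ← Real.rpow_add hr0, ← Real.rpow_natCast]
    congr 1
    push_cast
    ring
  set e := Real.exp (2 * σ * |(k : ℝ)|) with he
  have he0 : 0 < e := Real.exp_pos _
  have q1 : r ^ (n + 1) * e ≤ 2 ^ (n + 1) * yWeight σ (n + 1) k 0 := by
    rw [yWeight, Fin.val_zero, Nat.sub_zero, ← Finset.sum_mul, ← mul_assoc]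
    exact mul_le_mul_of_nonneg_right (one_add_pow_le k (n + 1)) he0.le
  have q2 : r ^ n * e ≤ 2 ^ (n + 1) * yWeight σ (n + 1) k 1 := by
    have h3 : r ^ n * e ≤ 2 ^ n * yWeight σ (n + 1) k 1 := by
      rw [yWeight, Fin.val_one, Nat.add_sub_cancel, ← Finset.sum_mul, ← mul_assoc]
      exact mul_le_mul_of_nonneg_right (one_add_pow_le k n) he0.le
    refine h3.trans (mul_le_mul_of_nonneg_right ?_ (yWeight_nonneg _ _ _ _))
    exact pow_le_pow_right₀ one_le_two (Nat.le_succ n)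
  have q3 : yWeight σ (n + 1) k 0 * ‖u.D 0‖ ^ 2 + yWeight σ (n + 1) k 1 * ‖u.D 1‖ ^ 2 ≤
      yTerm σ (n + 1) k u := by
    rw [yTerm_eq, Fin.sum_univ_succ, Fin.sum_univ_succ, ← add_assoc]
    refine le_add_of_nonneg_right (Finset.sum_nonneg fun p _ =>
      mul_nonneg (yWeight_nonneg _ _ _ _) (sq_nonneg _))
  calc xTerm σ (((n + 1 : ℕ) : ℝ) - 1 / 2) k (Sobolev.ev t u)
      = r ^ (((n + 1 : ℕ) : ℝ) - 1 / 2) * e * ‖Sobolev.ev t u‖ ^ 2 := rfl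
    _ ≤ r ^ (((n + 1 : ℕ) : ℝ) - 1 / 2) * e *
          (2 * (Real.sqrt r * ‖u.D 0‖ ^ 2 + d * ‖u.D 1‖ ^ 2)) :=
        mul_le_mul_of_nonneg_left h2 (by positivity)
    _ = 2 * ((r ^ (((n + 1 : ℕ) : ℝ) - 1 / 2) * Real.sqrt r) * e * ‖u.D 0‖ ^ 2 +
          (r ^ (((n + 1 : ℕ) : ℝ) - 1 / 2) * d) * e * ‖u.D 1‖ ^ 2) := by ring
    _ = 2 * (r ^ (n + 1) * e * ‖u.D 0‖ ^ 2 + r ^ n * e * ‖u.D 1‖ ^ 2) := by rw [p1, p2]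
    _ ≤ 2 * (2 ^ (n + 1) * yWeight σ (n + 1) k 0 * ‖u.D 0‖ ^ 2 +
          2 ^ (n + 1) * yWeight σ (n + 1) k 1 * ‖u.D 1‖ ^ 2) := by gcongr
    _ = 2 ^ (n + 2) * (yWeight σ (n + 1) k 0 * ‖u.D 0‖ ^ 2 +
          yWeight σ (n + 1) k 1 * ‖u.D 1‖ ^ 2) := by ring
    _ ≤ 2 ^ (n + 2) * yTerm σ (n + 1) k u := by gcongr

/-- The trace `a ↦ a(·, t)`, `t ∈ [0,1]`, as a continuous function. -/
def traceFun (t : ℝ) (a : YSpace σ (n + 1)) : C(Torus, ℂ) :=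
  ⟨fun x => Sobolev.ev t (a.toFun x), by fun_prop⟩

lemma fourierCoeff_traceFun (t : ℝ) (a : YSpace σ (n + 1)) (k : ℤ) :
    fourierCoeff (traceFun t a) k = Sobolev.ev t (a.coef k) :=
  fourierCoeff_comp (Sobolev.ev t) a.toFun k

lemma xTerm_nonneg (s : ℝ) (k : ℤ) (c : ℂ) : 0 ≤ xTerm σ s k c := by
  rw [xTerm]; positivity

lemma summable_traceFun {t : ℝ} (ht : t ∈ Icc (0 : ℝ) 1) (a : YSpace σ (n + 1)) :
    Summable fun k =>
      xTerm σ (((n + 1 : ℕ) : ℝ) - 1 / 2) k (fourierCoeff (traceFun t a) k) := by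
  refine Summable.of_nonneg_of_le (fun k => xTerm_nonneg _ _ _) (fun k => ?_)
    (a.summable_yTerm.mul_left (2 ^ (n + 2)))
  rw [fourierCoeff_traceFun]
  exact xTerm_ev_le k _ ht

/-- The trace `a ↦ a(·, t)`, `t ∈ [0,1]`. -/
def traceL {t : ℝ} (ht : t ∈ Icc (0 : ℝ) 1) :
    YSpace σ (n + 1) →L[ℂ] XSpace σ (((n + 1 : ℕ) : ℝ) - 1 / 2) :=
  LinearMap.mkContinuous
    { toFun := fun a => ⟨traceFun t a, summable_traceFun ht a⟩
      map_add' := fun a b => Subtype.ext (ContinuousMap.ext fun x =>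
        (Sobolev.ev t).map_add (a.toFun x) (b.toFun x))
      map_smul' := fun c a => Subtype.ext (ContinuousMap.ext fun x =>
        (Sobolev.ev t).map_smul c (a.toFun x)) } (Real.sqrt (2 ^ (n + 2)))
    fun a => by
      refine Real.sqrt_le_iff.2 ⟨by positivity, ?_⟩
      rw [mul_pow, Real.sq_sqrt (by positivity), norm_sq, ← tsum_mul_left]
      refine (summable_traceFun ht a).tsum_le_tsum (fun k => ?_) (a.summable_yTerm.mul_left _)
      refine le_trans (le_of_eq ?_) (xTerm_ev_le k (a.coef k) ht)
      exact congrArg _ (fourierCoeff_traceFun t a k)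

lemma val_traceL {t : ℝ} (ht : t ∈ Icc (0 : ℝ) 1) (a : YSpace σ (n + 1)) (x : ℝ) :
    (traceL ht a).val x = a.val x t :=
  Sobolev.ev_apply _ ht

end YSpace

namespace YSpace

variable {σ : ℝ} {n : ℕ}

/-! ### The algebra structure of `Y_σ^n`, `n ≥ 2` -/

lemma exists_conv (hσ : 0 < σ) (n : ℕ) : ∃ K : ℝ, ∀ a b : YSpace σ (n + 2), ∃ c : YSpace σ (n + 2),
    ‖c‖ ≤ K * ‖a‖ * ‖b‖ ∧
      ∀ k, (c.coef k).D 0 = conv (fun j => (a.coef j).D 0) (fun j => (b.coef j).D 0) k := by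
  obtain ⟨C, hC, h⟩ := exists_inY_conv hσ.le (n + 2) (n + 2) (n + 2) le_rfl le_rfl (by omega)
  obtain ⟨C', hC', h'⟩ := exists_ySum_le_of_inY (σ := σ) (n + 2)
  refine ⟨Real.sqrt (C' * C).toReal, fun a b => ?_⟩
  have h1 := h _ _ _ _ (by rw [ySum_coef]; exact ENNReal.ofReal_ne_top)
    (by rw [ySum_coef]; exact ENNReal.ofReal_ne_top) (inY_ySum a.coef) (inY_ySum b.coef)
  obtain ⟨s, hs, hle⟩ := h' _ _ h1
  rw [ySum_coef, ySum_coef] at hle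
  have htop : C' * (C * ENNReal.ofReal (‖a‖ ^ 2) * ENNReal.ofReal (‖b‖ ^ 2)) ≠ ⊤ :=
    ENNReal.mul_ne_top hC' (ENNReal.mul_ne_top (ENNReal.mul_ne_top hC ENNReal.ofReal_ne_top)
      ENNReal.ofReal_ne_top)
  obtain ⟨c, hc⟩ := exists_coef_eq hσ (summable_of_ySum (hle.trans_lt htop.lt_top).ne)
  obtain rfl : c.coef = s := funext hc
  refine ⟨c, ?_, hs⟩
  refine abs_le_of_sq_le_sq' ?_ (by positivity) |>.2
  rw [ySum_coef] at hle
  have h2 := ENNReal.toReal_mono htop hle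
  rw [ENNReal.toReal_ofReal (sq_nonneg _), ENNReal.toReal_mul, ENNReal.toReal_mul,
    ENNReal.toReal_mul, ENNReal.toReal_ofReal (sq_nonneg _),
    ENNReal.toReal_ofReal (sq_nonneg _)] at h2
  rw [mul_pow, mul_pow, Real.sq_sqrt ENNReal.toReal_nonneg, ENNReal.toReal_mul]
  exact h2.trans (le_of_eq (by ring))

lemma summable_norm_rep (hσ : 0 < σ) (a : YSpace σ (n + 1)) :
    Summable fun k => ‖Sobolev.rep (a.coef k)‖ :=
  Summable.of_nonneg_of_le (fun _ => norm_nonneg _)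
    (fun k => Sobolev.rep.le_opNorm (a.coef k))
    ((summable_norm hσ a.summable_yTerm).mul_left _)

/-- The pairs of summands of a convolution. -/
def convEquiv : ℤ × ℤ ≃ ℤ × ℤ where
  toFun p := (p.2, p.1 - p.2)
  invFun p := (p.1 + p.2, p.1)
  left_inv p := by ext <;> simp
  right_inv p := by ext <;> simp

/-- Cauchy product of two absolutely convergent Fourier series, with the double sum reindexed by `k
= j + (k - j)`. The convolution of coefficients can be evaluated at `t` because it also converges
uniformly in `ψ`. -/
lemma val_of_conv (hσ : 0 < σ) {a b c : YSpace σ (n + 1)}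
    (h : ∀ k, (c.coef k).D 0 = conv (fun j => (a.coef j).D 0) (fun j => (b.coef j).D 0) k)
    (x : ℝ) {t : ℝ} (ht : t ∈ Icc (0 : ℝ) 1) : c.val x t = a.val x t * b.val x t := by
  have hU := summable_norm_rep hσ a
  have hV := summable_norm_rep hσ b
  have hUV : ∀ k : ℤ, Summable fun j => Sobolev.rep (a.coef j) * Sobolev.rep (b.coef (k - j)) := by
    intro k
    refine Summable.of_norm_bounded (hU.mul_right (∑' l, ‖Sobolev.rep (b.coef l)‖)) fun j => ?_
    exact (norm_mul_le _ _).trans (mul_le_mul_of_nonneg_left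
      (hV.le_tsum (k - j) fun _ _ => norm_nonneg _) (norm_nonneg _))
  have hev : ∀ k, Sobolev.ev t (c.coef k) =
      ∑' j, Sobolev.ev t (a.coef j) * Sobolev.ev t (b.coef (k - j)) := by
    intro k
    have h1 : (c.coef k).D 0 =
        incl (∑' j, Sobolev.rep (a.coef j) * Sobolev.rep (b.coef (k - j))) := by
      rw [h, conv, incl.map_tsum (hUV k)]
      refine tsum_congr fun j => ?_
      rw [← Sobolev.incl_rep, ← Sobolev.incl_rep, mulL2_incl_left, mulBL_incl]
    rw [Sobolev.ev_apply _ ht, Sobolev.val_eq_of_ae h1 ht, ← evB_apply, (evB t).map_tsum (hUV k)]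
    rfl
  have hsum : ∀ d : YSpace σ (n + 1),
      Summable fun k => ‖fourier k (x : Torus) * Sobolev.ev t (d.coef k)‖ := by
    intro d
    refine Summable.of_nonneg_of_le (fun _ => norm_nonneg _) (fun k => ?_)
      (summable_norm_rep hσ d)
    rw [norm_mul, norm_fourier_apply, one_mul]
    exact (Sobolev.rep (d.coef k)).norm_coe_le_norm t
  rw [← (hasSum_val hσ a x ht).tsum_eq, ← (hasSum_val hσ b x ht).tsum_eq,
    ← (hasSum_val hσ c x ht).tsum_eq, tsum_mul_tsum_of_summable_norm (hsum a) (hsum b),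
    ← convEquiv.tsum_eq]
  have hp := (summable_mul_of_summable_norm (hsum a) (hsum b))
  rw [← convEquiv.summable_iff] at hp
  have hp' := hp.tsum_prod
  simp only [Function.comp_apply] at hp'
  rw [hp']
  refine tsum_congr fun k => ?_
  rw [hev, ← tsum_mul_left]
  refine tsum_congr fun j => ?_
  simp only [convEquiv, Equiv.coe_fn_mk]
  have : (fourier k (x : Torus) : ℂ) = fourier j (x : Torus) * fourier (k - j) (x : Torus) := by
    rw [← fourier_add, add_sub_cancel]
  rw [this]
  ring

/-- Values determine an element, so bilinearity is inherited from multiplication of complex numbers.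
-/
lemma exists_mulL (hσ : 0 < σ) (n : ℕ) :
    ∃ M : YSpace σ (n + 2) →L[ℂ] YSpace σ (n + 2) →L[ℂ] YSpace σ (n + 2),
      ∀ a b, ∀ x : ℝ, ∀ t ∈ Icc (0 : ℝ) 1, (M a b).val x t = a.val x t * b.val x t := by
  obtain ⟨K, hK⟩ := exists_conv hσ n
  choose f hf hf' using hK
  have hval : ∀ a b, ∀ x : ℝ, ∀ t ∈ Icc (0 : ℝ) 1, (f a b).val x t = a.val x t * b.val x t :=
    fun a b x t ht => val_of_conv hσ (hf' a b) x ht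
  refine ⟨LinearMap.mkContinuous₂ (LinearMap.mk₂ ℂ f ?_ ?_ ?_ ?_) K hf, hval⟩
  · refine fun a a' b => ext_val fun x t ht => ?_
    rw [hval _ _ x t ht, val_add _ _ x ht, val_add _ _ x ht, hval _ _ x t ht, hval _ _ x t ht,
      add_mul]
  · refine fun c a b => ext_val fun x t ht => ?_
    rw [hval _ _ x t ht, val_smul _ _ x ht, val_smul _ _ x ht, hval _ _ x t ht, mul_assoc]
  · refine fun a b b' => ext_val fun x t ht => ?_
    rw [hval _ _ x t ht, val_add _ _ x ht, val_add _ _ x ht, hval _ _ x t ht, hval _ _ x t ht,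
      mul_add]
  · refine fun c a b => ext_val fun x t ht => ?_
    rw [hval _ _ x t ht, val_smul _ _ x ht, val_smul _ _ x ht, hval _ _ x t ht, mul_left_comm]

/-- Multiplication in `Y_σ^{n+2}`. -/
def mulL (hσ : 0 < σ) : YSpace σ (n + 2) →L[ℂ] YSpace σ (n + 2) →L[ℂ] YSpace σ (n + 2) :=
  (exists_mulL hσ n).choose

lemma val_mulL (hσ : 0 < σ) (a b : YSpace σ (n + 2)) (x : ℝ) {t : ℝ} (ht : t ∈ Icc (0 : ℝ) 1) :
    (mulL hσ a b).val x t = a.val x t * b.val x t :=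
  (exists_mulL hσ n).choose_spec a b x t ht

end YSpace

/-! ### Partial derivatives of values -/

section Partials

variable {σ : ℝ} {n : ℕ} {b : ℝ → ℝ → ℂ} {c : YSpace σ (n + 2)}

/-- Agreement is required only on the strip, so that this and the next two lemmas can be iterated:
off `[0,1]` the functions `dx a.val` and `dψ a.val` are not controlled. -/
lemma hasPartials_of_eq (hσ : 0 < σ) (h : ∀ x : ℝ, ∀ t ∈ Icc (0 : ℝ) 1, b x t = c.val x t) :
    HasPartials b := by
  intro x t ht
  constructor
  · have e : (fun y => b y t) = fun y => c.val y t := funext fun y => h y t ht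
    rw [e]
    exact (YSpace.hasDerivAt_val hσ c x ht).differentiableAt
  · exact ((YSpace.hasDerivWithinAt_val hσ c x ht).differentiableWithinAt).congr (h x) (h x t ht)

lemma dx_of_eq (hσ : 0 < σ) (h : ∀ x : ℝ, ∀ t ∈ Icc (0 : ℝ) 1, b x t = c.val x t) :
    ∀ x : ℝ, ∀ t ∈ Icc (0 : ℝ) 1, dx b x t = (YSpace.dxL hσ c).val x t := by
  intro x t ht
  have e : (fun y => b y t) = fun y => c.val y t := funext fun y => h y t ht
  rw [dx, e]
  exact (YSpace.hasDerivAt_val hσ c x ht).deriv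

lemma dψ_of_eq (hσ : 0 < σ) (h : ∀ x : ℝ, ∀ t ∈ Icc (0 : ℝ) 1, b x t = c.val x t) :
    ∀ x : ℝ, ∀ t ∈ Icc (0 : ℝ) 1, dψ b x t = (YSpace.dψL hσ c).val x t := by
  intro x t ht
  rw [dψ, derivWithin_congr (h x) (h x t ht)]
  exact (YSpace.hasDerivWithinAt_val hσ c x ht).derivWithin (uniqueDiffOn_Icc zero_lt_one t ht)

end Partials

/-! ### The functions `1` and `ψ` -/

namespace Sobolev

/-- The function `1`. -/
def one (n : ℕ) : Sobolev n :=
  ⟨WithLp.toLp 2 fun p => if p = 0 then incl (constB 1) else 0, fun j => by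
    change IsWeakDeriv (if j.castSucc = 0 then incl (constB 1) else 0)
      (if j.succ = 0 then incl (constB 1) else 0)
    rw [if_neg (Fin.succ_ne_zero j)]
    split_ifs
    · simpa using isWeakDeriv_prim 1 0
    · exact isWeakDeriv_zero⟩

lemma one_D_zero (n : ℕ) : (one n).D 0 = incl (constB 1) := rfl

/-- The function `ψ`. -/
def id (n : ℕ) : Sobolev (n + 1) :=
  cons (incl (primL (incl (constB 1)))) (one n) (by
    simpa [one_D_zero] using isWeakDeriv_prim 0 (incl (constB 1)))

lemma one_val (n : ℕ) {t : ℝ} (ht : t ∈ Icc (0 : ℝ) 1) : (one n).val t = 1 := by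
  rw [val_eq_of_ae (one_D_zero n) ht, constB_apply]

lemma id_val (n : ℕ) {t : ℝ} (ht : t ∈ Icc (0 : ℝ) 1) : (id n).val t = t := by
  rw [val_eq_of_ae (f := primL (incl (constB 1))) rfl ht, primL_incl _ ht]
  simp [constB_apply]

end Sobolev

/-! ### Division by `a_ψ` and the operator `Φ` on `Y_σ^{n+4}` -/

namespace YSpace

variable {σ : ℝ} {n : ℕ}

lemma mulL_one (hσ : 0 < σ) : mulL hσ (constL hσ (Sobolev.one (n + 2))) = 1 := by
  ext b
  refine ext_val fun x t ht => ?_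
  rw [val_mulL hσ _ _ x ht, val_constL, Sobolev.one_val _ ht, one_mul]
  rfl

/-- `a ↦ a_ψ`, `Y_σ^{n+2} → Y_σ^n`. -/
def dψR (hσ : 0 < σ) : YSpace σ (n + 2) →L[ℂ] YSpace σ n := resL hσ ∘L dψL hσ

/-- `a ↦ a_x`, `Y_σ^{n+2} → Y_σ^n`. -/
def dxR (hσ : 0 < σ) : YSpace σ (n + 2) →L[ℂ] YSpace σ n := resL hσ ∘L dxL hσ

lemma dψR_id (hσ : 0 < σ) :
    dψR hσ (constL hσ (Sobolev.id (n + 1))) = constL hσ (Sobolev.one n) := by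
  refine ext_coef fun k => ?_
  rw [dψR, ContinuousLinearMap.comp_apply, coef_resL, coef_dψL, coef_constL, coef_constL]
  split_ifs
  · exact Sobolev.ext_zero rfl
  · rw [map_zero, map_zero]

/-- Linearity gives `1 - mulL hσ (dψR hσ a) = L (ψ - a)`, whose norm is below one by the choice of
radius, and a Neumann series inverts the operator. The `+ 1` keeps the radius meaningful if `L`
vanishes. -/
lemma isUnit_mulL (hσ : 0 < σ) {a : YSpace σ (n + 4)}
    (ha : a ∈ Metric.ball (constL hσ (Sobolev.id (n + 3)))
      (‖mulL hσ ∘L dψR (n := n + 2) hσ‖ + 1)⁻¹) : IsUnit (mulL hσ (dψR hσ a)) := by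
  have := completeSpace (σ := σ) (n := n + 2) hσ
  set L := mulL hσ ∘L dψR (n := n + 2) hσ with hL
  have h1 : 1 - mulL hσ (dψR hσ a) = L (constL hσ (Sobolev.id (n + 3)) - a) := by
    rw [map_sub, hL, ContinuousLinearMap.comp_apply, ContinuousLinearMap.comp_apply, dψR_id,
      mulL_one]
  have h2 : ‖1 - mulL hσ (dψR hσ a)‖ < 1 := by
    rw [h1]
    rw [Metric.mem_ball', dist_eq_norm] at ha
    refine (L.le_opNorm _).trans_lt ?_
    have h3 : 0 < ‖L‖ + 1 := by positivity
    rw [← one_div, lt_div_iff₀ h3] at ha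
    have h4 := norm_nonneg (constL hσ (Sobolev.id (n + 3)) - a)
    rcases h4.eq_or_lt with h | h
    · rw [← h]; simp
    · linarith
  have h3 := (Units.oneSub _ h2).isUnit
  rwa [Units.val_oneSub, sub_sub_cancel] at h3

/-- Division by `a_ψ`. -/
def divL (hσ : 0 < σ) (a : YSpace σ (n + 4)) : YSpace σ (n + 2) →L[ℂ] YSpace σ (n + 2) :=
  Ring.inverse (mulL hσ (dψR hσ a))

/-- The operator `Φ` as a map `Y_σ^{n+4} → Y_σ^{n+2}`. -/
def phiY (hσ : 0 < σ) (a : YSpace σ (n + 4)) : YSpace σ (n + 2) :=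
  (2 : ℂ) • divL hσ a (divL hσ a (mulL hσ (dxR hσ a) (dψL hσ (dxL hσ a))))
    + (-1 : ℂ) • (divL hσ a (dxL hσ (dxL hσ a))
      + divL hσ a (divL hσ a (divL hσ a
        (dψL hσ (dψL hσ a) + mulL hσ (mulL hσ (dxR hσ a) (dxR hσ a)) (dψL hσ (dψL hσ a))))))

lemma val_mul_divL (hσ : 0 < σ) {a : YSpace σ (n + 4)} (ha : IsUnit (mulL hσ (dψR hσ a)))
    (w : YSpace σ (n + 2)) (x : ℝ) {t : ℝ} (ht : t ∈ Icc (0 : ℝ) 1) :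
    (dψL hσ a).val x t * (divL hσ a w).val x t = w.val x t := by
  rw [← val_resL hσ _ x ht]
  change (dψR hσ a).val x t * _ = _
  rw [← val_mulL hσ _ _ x ht]
  have h := Ring.mul_inverse_cancel _ ha
  have h2 := congrArg (fun L : YSpace σ (n + 2) →L[ℂ] YSpace σ (n + 2) => L w) h
  exact congrArg (fun c : YSpace σ (n + 2) => c.val x t) h2

/-- Dividing the function `1` by `a_ψ` produces a pointwise inverse. -/
lemma val_dψL_ne_zero (hσ : 0 < σ) {a : YSpace σ (n + 4)} (ha : IsUnit (mulL hσ (dψR hσ a)))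
    (x : ℝ) {t : ℝ} (ht : t ∈ Icc (0 : ℝ) 1) : (dψL hσ a).val x t ≠ 0 := by
  have h := val_mul_divL hσ ha (constL hσ (Sobolev.one (n + 2))) x ht
  rw [val_constL, Sobolev.one_val _ ht] at h
  exact left_ne_zero_of_mul_eq_one h

lemma val_divL (hσ : 0 < σ) {a : YSpace σ (n + 4)} (ha : IsUnit (mulL hσ (dψR hσ a)))
    (w : YSpace σ (n + 2)) (x : ℝ) {t : ℝ} (ht : t ∈ Icc (0 : ℝ) 1) :
    (divL hσ a w).val x t = w.val x t / (dψL hσ a).val x t := by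
  rw [eq_div_iff (val_dψL_ne_zero hσ ha x ht), mul_comm, val_mul_divL hσ ha w x ht]

lemma val_phiY (hσ : 0 < σ) {a : YSpace σ (n + 4)} (ha : IsUnit (mulL hσ (dψR hσ a)))
    (x : ℝ) {t : ℝ} (ht : t ∈ Icc (0 : ℝ) 1) : (phiY hσ a).val x t = Phi a.val x t := by
  have h0 : ∀ x : ℝ, ∀ t ∈ Icc (0 : ℝ) 1, a.val x t = a.val x t := fun _ _ _ => rfl
  have hx := dx_of_eq hσ h0
  have hψ := dψ_of_eq hσ h0
  have hne := val_dψL_ne_zero hσ ha x ht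
  have hr : (dxR hσ a).val x t = (dxL hσ a).val x t := val_resL hσ _ x ht
  rw [Phi, hx x t ht, hψ x t ht, dx_of_eq hσ hx x t ht, dψ_of_eq hσ hx x t ht,
    dψ_of_eq hσ hψ x t ht]
  simp only [phiY, val_add _ _ x ht, val_smul _ _ x ht, val_divL hσ ha _ x ht,
    val_mulL hσ _ _ x ht, hr]
  field_simp
  ring

/-- `Ring.inverse` is analytic at units of the complete normed algebra of operators, and everything
else is a composition of bounded linear and bilinear maps. -/
lemma analyticAt_phiY (hσ : 0 < σ) {a : YSpace σ (n + 4)}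
    (ha : IsUnit (mulL hσ (dψR hσ a))) : AnalyticAt ℂ (phiY hσ) a := by
  have := completeSpace (σ := σ) (n := n + 2) hσ
  have hI : AnalyticAt ℂ (divL hσ) a := by
    obtain ⟨z, hz⟩ := ha
    have h1 : AnalyticAt ℂ Ring.inverse (mulL hσ (dψR hσ a)) := hz ▸ analyticAt_inverse z
    exact AnalyticAt.comp (f := fun a : YSpace σ (n + 4) => mulL hσ (dψR hσ a)) h1
      ((mulL hσ ∘L dψR hσ).analyticAt a)
  have hdiv : ∀ {w : YSpace σ (n + 4) → YSpace σ (n + 2)}, AnalyticAt ℂ w a →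
      AnalyticAt ℂ (fun a => divL hσ a (w a)) a := fun hw =>
    AnalyticAt.comp (f := fun a => (divL hσ a, _))
      ((ContinuousLinearMap.id ℂ (YSpace σ (n + 2) →L[ℂ] YSpace σ (n + 2))).analyticAt_bilinear _)
      (hI.prod hw)
  have hmul : ∀ {v w : YSpace σ (n + 4) → YSpace σ (n + 2)}, AnalyticAt ℂ v a →
      AnalyticAt ℂ w a → AnalyticAt ℂ (fun a => mulL hσ (v a) (w a)) a := fun hv hw =>
    AnalyticAt.comp ((mulL hσ).analyticAt_bilinear _) (hv.prod hw)
  have hx : AnalyticAt ℂ (fun a : YSpace σ (n + 4) => dxR hσ a) a := (dxR hσ).analyticAt a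
  have hxx : AnalyticAt ℂ (fun a : YSpace σ (n + 4) => dxL hσ (dxL hσ a)) a :=
    (dxL hσ ∘L dxL hσ).analyticAt a
  have hxψ : AnalyticAt ℂ (fun a : YSpace σ (n + 4) => dψL hσ (dxL hσ a)) a :=
    (dψL hσ ∘L dxL hσ).analyticAt a
  have hψψ : AnalyticAt ℂ (fun a : YSpace σ (n + 4) => dψL hσ (dψL hσ a)) a :=
    (dψL hσ ∘L dψL hσ).analyticAt a
  have h1 := (hdiv (hdiv (hmul hx hxψ))).const_smul (c := (2 : ℂ))
  have h2 := ((hdiv hxx).add (hdiv (hdiv (hdiv (hψψ.add (hmul (hmul hx hx) hψψ)))))).const_smul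
    (c := (-1 : ℂ))
  exact h1.add h2

end YSpace

end FlowLines

end

/-! ### Assembly of the operator `T` -/

open FlowLines
theorem mainTheorem2 (σ : ℝ) (hσ : 0 < σ) (m : ℕ) (hm : 3 < m) :
    ∃ a₀ : YSpace σ m, (∀ x : ℝ, ∀ ψ ∈ Set.Icc (0 : ℝ) 1, a₀.val x ψ = (ψ : ℂ)) ∧
    ∃ ε : ℝ, 0 < ε ∧
    ∃ T : XSpace σ ((m : ℝ) - 1 / 2) × XSpace σ ((m : ℝ) - 1 / 2) × Sobolev (m - 2) × YSpace σ m →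
        YSpace σ (m - 2) × XSpace σ ((m : ℝ) - 1 / 2) × XSpace σ ((m : ℝ) - 1 / 2),
      (∀ a ∈ Metric.ball a₀ ε,
        HasPartials a.val ∧ HasPartials (dx a.val) ∧ HasPartials (dψ a.val) ∧
        (∀ x : ℝ, ∀ ψ ∈ Set.Icc (0 : ℝ) 1, dψ a.val x ψ ≠ 0) ∧
        ∀ f g F,
          (∀ x : ℝ, ∀ ψ ∈ Set.Icc (0 : ℝ) 1,
            (T (f, g, F, a)).1.val x ψ = Phi a.val x ψ - F.val ψ) ∧
          (∀ x : ℝ, (T (f, g, F, a)).2.1.val x = a.val x 0 - f.val x) ∧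
          (∀ x : ℝ, (T (f, g, F, a)).2.2.val x = a.val x 1 - g.val x)) ∧
      AnalyticOnNhd ℂ T {p | p.2.2.2 ∈ Metric.ball a₀ ε} := by
  -- Then `m - 2` is `n + 2`, the range in which `Y_σ` is closed under multiplication.
  obtain ⟨n, rfl⟩ : ∃ n, m = n + 4 := ⟨m - 4, by omega⟩
  have h0 : (0 : ℝ) ∈ Set.Icc (0 : ℝ) 1 := by simp
  have h1 : (1 : ℝ) ∈ Set.Icc (0 : ℝ) 1 := by simp
  let X := XSpace σ (((n + 3 + 1 : ℕ) : ℝ) - 1 / 2)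
  let T : X × X × Sobolev (n + 2) × YSpace σ (n + 4) → YSpace σ (n + 2) × X × X :=
    fun p => (YSpace.phiY hσ p.2.2.2 - YSpace.constL hσ p.2.2.1,
      YSpace.traceL h0 p.2.2.2 - p.1, YSpace.traceL h1 p.2.2.2 - p.2.1)
  refine ⟨YSpace.constL hσ (Sobolev.id (n + 3)), fun x ψ hψ => ?_,
    (‖YSpace.mulL hσ ∘L YSpace.dψR (n := n + 2) hσ‖ + 1)⁻¹, by positivity, T,
    fun a ha => ?_, fun p hp => ?_⟩
  · rw [YSpace.val_constL, Sobolev.id_val _ hψ]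
  · have hu := YSpace.isUnit_mulL hσ ha
    have hr : ∀ x : ℝ, ∀ t ∈ Set.Icc (0 : ℝ) 1, a.val x t = a.val x t := fun _ _ _ => rfl
    refine ⟨hasPartials_of_eq hσ hr, hasPartials_of_eq hσ (dx_of_eq hσ hr),
      hasPartials_of_eq hσ (dψ_of_eq hσ hr), fun x ψ hψ => ?_, fun f g (F : Sobolev (n + 2)) =>
      ⟨fun x ψ hψ => ?_, fun x => ?_, fun x => ?_⟩⟩
    · rw [dψ_of_eq hσ hr x ψ hψ]
      exact YSpace.val_dψL_ne_zero hσ hu x hψ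
    · change (YSpace.phiY hσ a - YSpace.constL hσ F).val x ψ = _
      have h := YSpace.val_add (YSpace.phiY hσ a - YSpace.constL hσ F) (YSpace.constL hσ F) x hψ
      rw [sub_add_cancel, YSpace.val_phiY hσ hu x hψ, YSpace.val_constL] at h
      rw [h, add_sub_cancel_right]
    · rw [← YSpace.val_traceL h0 a x]
      rfl
    · rw [← YSpace.val_traceL h1 a x]
      rfl
  · have hu := YSpace.isUnit_mulL hσ hp
    let Y := YSpace σ (n + 4)
    let S := Sobolev (n + 2)
    let pa : X × X × S × Y →L[ℂ] Y :=
      .snd ℂ S Y ∘L .snd ℂ X (S × Y) ∘L .snd ℂ X (X × S × Y)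
    let pF : X × X × S × Y →L[ℂ] S :=
      .fst ℂ S Y ∘L .snd ℂ X (S × Y) ∘L .snd ℂ X (X × S × Y)
    let pg : X × X × S × Y →L[ℂ] X := .fst ℂ X (S × Y) ∘L .snd ℂ X (X × S × Y)
    let pf : X × X × S × Y →L[ℂ] X := .fst ℂ X (X × S × Y)
    have e1 : AnalyticAt ℂ (fun p : X × X × S × Y => YSpace.phiY hσ (pa p)) p :=
      AnalyticAt.comp (f := pa) (YSpace.analyticAt_phiY hσ hu) (pa.analyticAt p)
    exact (e1.sub ((YSpace.constL hσ ∘L pF).analyticAt p)).prod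
      (((YSpace.traceL h0 ∘L pa - pf).analyticAt p).prod
        ((YSpace.traceL h1 ∘L pa - pg).analyticAt p))
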